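/- Let $d\ge 1$ be an integer, $T>0$, $Q_T=[0,T]^d$ and $p\in[1,+\infty)$. Let $L^p(\mathbb T^d_T)$ be the space of measurable functions $u:\mathbb R^d\to\mathbb R$ with $u(x+Te_i)=u(x)$ for a.e. $x\in\mathbb R^d$ and every $i=1,\dots,d$, and $u|_{Q_T}\in L^p(Q_T)$, with norm $\|u\|=\left(\int_{Q_T}|u|^p\,dx\right)^{1/p}$. As usual, functions that are equal almost everywhere are identified, and $\rightharpoonup$ denotes weak convergence in $L^p(\mathbb T^d_T)$. Write $\langle u\rangle = T^{-d}\int_{Q_T}u\,dx$ for the average of $u$. For $s\in(0,1)$ and $u\in L^p(\mathbb T^d_T)$ put $$\mathcal F^s_p(u)=\int_{Q_T}\int_{\mathbb R^d}\frac{|u(x)-u(y)|^p}{|x-y|^{d+sp}}\,dy\,dx\in[0,+\infty],\qquad \mathcal F^0_p(u)=\int_{Q_T}\int_{Q_T}|u(x)-u(y)|^p\,dy\,dx,$$ and let $\omega_d$ be the Lebesgue measure of the unit ball of $\mathbb R^d$, so that $d\omega_d$ is the surface measure of the unit sphere $\mathbb S^{d-1}$. **Theorem** ($\Gamma$-convergence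 for $s\to0^+$). Let $(s_n)_n\subset(0,1)$ with $s_n\to0^+$ as $n\to+\infty$. 1. (Compactness.) Assume $p\ne1$, and let $(u_n)_n\subset L^p(\mathbb T^d_T)$ and $C\in\mathbb R$ satisfy $\sup_n s_n\mathcal F^{s_n}_p(u_n)\le C$. Then there are a subsequence $(u_{n_k})_k$ and a function $u\in L^p(\mathbb T^d_T)$ with $\langle u\rangle=0$ such that $u_{n_k}-\langle u_{n_k}\rangle\rightharpoonup u$ in $L^p(\mathbb T^d_T)$. 2. ($\Gamma$-liminf inequality.) For all $u\in L^p(\mathbb T^d_T)$ and all $(u_n)_n\subset L^p(\mathbb T^d_T)$ with $u_n\rightharpoonup u$ in $L^p(\mathbb T^d_T)$, $$\liminf_{n\to+\infty}s_n\mathcal F^{s_n}_p(u_n)\ge\frac{d\,\omega_d}{p\,T^d}\,\mathcal F^0_p(u).$$ 3. ($\Gamma$-limsup inequality.) For all $u\in L^p(\mathbb T^d_T)$ there is $(u_n)_n\subset L^p(\mathbb T^d_T)$ with $u_n\rightharpoonup u$ in $L^p(\mathbb T^d_T)$ and $$\limsup_{n\to+\infty}s_n\mathcal F^{s_n}_p(u_n)\le\frac{d\,\omega_d}{p\,T^d}\,\mathcal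 F^0_p(u).$$ -/

import Mathlib

open MeasureTheory Filter Topology
open scoped ENNReal

namespace PeriodicGagliardo

noncomputable section

/-- The closed periodicity cell `Q_T = [0, T]^d` in Euclidean space `ℝ^d`. -/
def cell (d : ℕ) (T : ℝ) : Set (EuclideanSpace ℝ (Fin d)) :=
  {x | ∀ i, x i ∈ Set.Icc 0 T}

theorem cell_volume_lt_top (d : ℕ) (T : ℝ) : volume (cell d T) < ∞ := by
  have h : cell d T = WithLp.toLp 2 '' (Set.univ.pi fun _ : Fin d => Set.Icc (0 : ℝ) T) := by
    ext x
    constructor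
    · intro hx
      exact ⟨WithLp.ofLp x, fun i _ => hx i, rfl⟩
    · rintro ⟨y, hy, rfl⟩ i
      exact hy i (Set.mem_univ i)
  rw [h]
  exact ((isCompact_univ_pi fun _ => isCompact_Icc).image
    (PiLp.continuous_toLp 2 _)).measure_lt_top

instance instIsFiniteMeasureCell (d : ℕ) (T : ℝ) :
    IsFiniteMeasure ((volume : Measure (EuclideanSpace ℝ (Fin d))).restrict (cell d T)) :=
  ⟨by rw [Measure.restrict_apply_univ]; exact cell_volume_lt_top d T⟩

instance instFactOneLeOfReal (p : ℝ) [h : Fact (1 ≤ p)] : Fact (1 ≤ ENNReal.ofReal p) :=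
  ⟨by rw [← ENNReal.ofReal_one]; exact ENNReal.ofReal_le_ofReal h.out⟩

/-- The (Lebesgue) measurable functions `u : ℝ^d → ℝ` which are `T`-periodic in each coordinate
direction (almost everywhere) and whose restriction to `Q_T` lies in `L^p(Q_T)`. -/
def periodicLp (d : ℕ) (T p : ℝ) : Submodule ℝ (EuclideanSpace ℝ (Fin d) → ℝ) where
  carrier := {u | AEStronglyMeasurable u volume ∧
    (∀ i : Fin d, ∀ᵐ x, u (x + T • EuclideanSpace.single i (1 : ℝ)) = u x) ∧
    MemLp u (ENNReal.ofReal p) (volume.restrict (cell d T))}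
  zero_mem' := ⟨aestronglyMeasurable_const, fun _ => Eventually.of_forall fun _ => rfl,
    MemLp.zero⟩
  add_mem' := by
    rintro u v ⟨hu, hu', hu''⟩ ⟨hv, hv', hv''⟩
    refine ⟨hu.add hv, fun i => ?_, hu''.add hv''⟩
    filter_upwards [hu' i, hv' i] with x h1 h2
    simp only [Pi.add_apply, h1, h2]
  smul_mem' := by
    rintro c u ⟨hu, hu', hu''⟩
    refine ⟨hu.const_smul c, fun i => ?_, hu''.const_smul c⟩
    filter_upwards [hu' i] with x h1
    simp only [Pi.smul_apply, h1]

/-- The space `L^p(𝕋_T^d)` of `T`-periodic `L^p` functions on `ℝ^d`. Its elements are functions, not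
almost everywhere classes: two functions are almost everywhere equal exactly when their
distance is `0`. It is a type of its own, so that it carries the norm of `L^p(Q_T)` and not the
topology of pointwise convergence. -/
def PerLp (d : ℕ) (T p : ℝ) : Type := periodicLp d T p

variable {d : ℕ} {T p : ℝ}

instance instAddCommGroupPerLp : AddCommGroup (PerLp d T p) :=
  inferInstanceAs (AddCommGroup (periodicLp d T p))

instance instModulePerLp : Module ℝ (PerLp d T p) :=
  inferInstanceAs (Module ℝ (periodicLp d T p))

instance instCoeFunPerLp : CoeFun (PerLp d T p) fun _ => EuclideanSpace ℝ (Fin d) → ℝ :=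
  ⟨fun u => u.1⟩

/-- Restriction to the periodicity cell, as a linear map `L^p(𝕋_T^d) → L^p(Q_T)`. -/
def PerLp.restrictCell (d : ℕ) (T p : ℝ) :
    PerLp d T p →ₗ[ℝ]
      Lp ℝ (ENNReal.ofReal p)
        ((volume : Measure (EuclideanSpace ℝ (Fin d))).restrict (cell d T)) where
  toFun u := MemLp.toLp u.1 u.2.2.2
  map_add' _ _ := rfl
  map_smul' _ _ := rfl

/-- The norm `‖u‖ = (∫_{Q_T} |u|^p)^{1/p}` on `L^p(𝕋_T^d)`. -/
instance instSeminormedAddCommGroupPerLp [Fact (1 ≤ p)] : SeminormedAddCommGroup (PerLp d T p) :=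
  SeminormedAddCommGroup.induced _ _ (PerLp.restrictCell d T p)

instance instNormedSpacePerLp [Fact (1 ≤ p)] : NormedSpace ℝ (PerLp d T p) :=
  NormedSpace.induced ℝ _ _ (PerLp.restrictCell d T p)

/-- Convergence of a sequence in the weak topology of `L^p(𝕋_T^d)`. -/
def WeakTendsto [Fact (1 ≤ p)] (u : ℕ → PerLp d T p) (v : PerLp d T p) : Prop :=
  Tendsto (fun n => toWeakSpace ℝ (PerLp d T p) (u n)) atTop
    (𝓝 (toWeakSpace ℝ (PerLp d T p) v))

/-- The average of `u` on the periodicity cell. -/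
def cellAverage (u : PerLp d T p) : ℝ := (1 / T ^ d) * ∫ x in cell d T, u x

/-- The function `u` minus its average on the periodicity cell. -/
def center (u : PerLp d T p) : PerLp d T p :=
  ⟨fun x => u x - cellAverage u, u.2.1.sub aestronglyMeasurable_const,
    fun i => by
      filter_upwards [u.2.2.1 i] with x hx
      rw [hx],
    u.2.2.2.sub (memLp_const (cellAverage u))⟩

/-- The energy `F_p^s(u) = ∫_{Q_T} ∫_{ℝ^d} |u(x) - u(y)|^p / |x - y|^{d + s p} dy dx`,
with values in `[0, ∞]`. -/
def energy (s : ℝ) (u : PerLp d T p) : ℝ≥0∞ :=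
  ∫⁻ x in cell d T, ∫⁻ y, ENNReal.ofReal (|u x - u y| ^ p / ‖x - y‖ ^ ((d : ℝ) + s * p))

/-- The energy `F_p^0(u) = ∬_{Q_T × Q_T} |u(x) - u(y)|^p dx dy`. -/
def energyZero (u : PerLp d T p) : ℝ≥0∞ :=
  ∫⁻ x in cell d T, ∫⁻ y in cell d T, ENNReal.ofReal (|u x - u y| ^ p)

/-- `ω_d`, the Lebesgue measure of the unit ball of `ℝ^d`; thus `d ω_d` is the surface measure of
the unit sphere. -/
def unitBallVolume (d : ℕ) : ℝ :=
  (volume (Metric.ball (0 : EuclideanSpace ℝ (Fin d)) 1)).toReal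

end

end PeriodicGagliardo

/-! The factor `s` kills every contribution to the energy except the one of the kernel at infinity.
For fixed `x` the function `φ(y) = |u x - u y|^p` is periodic, and far from `x` the kernel `|x -
y|^{-(d+sp)}` is nearly constant on each cell, so there `φ` may be replaced by its mean over `Q_T`.
In polar coordinates the mass of the kernel outside the ball of radius `R` is `d ω_d R^{-sp}/(sp)`,
hence the far part of `s F^s_p(u)` is close to `d ω_d/(p T^d) F^0_p(u)`.

This becomes a pair of inequalities by averaging over all translates of the cell
(`lintegral_mul_lintegral_cell_average`). For `|x - w| > R`, moving `w` within a cell changes the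
distance to `x` by a factor of at most `Λ = 1 + T√d/R`, so the error is a power of `Λ`, which tends
to `1` as `R → ∞`.

The lower inequality `lowerConst_mul_energyZero_le` holds for every `u`, since the near part is just
dropped. `F^0_p(u)` is the `p`-th power of the norm of `(x, y) ↦ u x - u y`, linear in `u`, so it is
weakly lower semicontinuous (`energyZero_le_liminf`); this gives the liminf inequality. With
Poincaré's inequality (`enorm_center_rpow_le`) and the weak sequential compactness of balls for `1 <
p < ∞`, it also gives compactness.

The upper inequality `energy_le_of_lipschitz` needs a Lipschitz `u`: then the near part stays
bounded as `s → 0`, and the factor `s` removes it. Density of Lipschitz periodic functions,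
continuity of `F^0_p` and a diagonal choice give recovery sequences that even converge in norm. -/

namespace PeriodicGagliardo

open scoped Pointwise

/-! ### Duality of `L^p` over a finite measure and weak sequential compactness. -/

section LpDuality

variable {α : Type*} {m : MeasurableSpace α} {μ : Measure α} [IsFiniteMeasure μ]

theorem finset_sum_indicatorConstLp {r : ℝ≥0∞} {f : ℕ → Set α} (hf : ∀ i, MeasurableSet (f i))
    (hd : Pairwise (Function.onFun Disjoint f)) (S : Finset ℕ) :
    ∑ i ∈ S, indicatorConstLp r (hf i) (measure_ne_top μ (f i)) (1 : ℝ) =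
      indicatorConstLp r (S.measurableSet_biUnion fun i _ => hf i)
        (measure_ne_top μ (⋃ i ∈ S, f i)) 1 := by
  induction S using Finset.induction_on with
  | empty => simp [indicatorConstLp_empty]
  | insert a S ha ih =>
    rw [Finset.sum_insert ha, ih]
    rw [← indicatorConstLp_disjoint_union (hf a) (S.measurableSet_biUnion fun i _ => hf i)]
    · congr 1
      simp
    · rw [Set.disjoint_iUnion₂_right]
      intro i hi
      exact hd (fun h => ha (h ▸ hi))

/-- The tails of a disjoint union decrease to the empty set, so their measure tends to `0`, and for
`r < ∞` this is convergence in `L^r`. It provides the σ-additivity of `functionalMeasure`. -/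
theorem hasSum_indicatorConstLp {r : ℝ≥0∞} [Fact (1 ≤ r)] (hr : r ≠ ∞) {f : ℕ → Set α}
    (hf : ∀ i, MeasurableSet (f i)) (hd : Pairwise (Function.onFun Disjoint f)) :
    HasSum (fun i => indicatorConstLp r (hf i) (measure_ne_top μ (f i)) (1 : ℝ))
      (indicatorConstLp r (MeasurableSet.iUnion hf) (measure_ne_top μ (⋃ i, f i)) 1) := by
  unfold HasSum
  simp only [finset_sum_indicatorConstLp hf hd]
  refine tendsto_indicatorConstLp_set hr ?_
  have hle : ∀ S : Finset ℕ, symmDiff (⋃ i ∈ S, f i) (⋃ i, f i) = (⋃ i, f i) \ ⋃ i ∈ S, f i := by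
    intro S
    exact symmDiff_of_le (Set.iUnion₂_subset fun i _ => Set.subset_iUnion f i)
  simp only [hle]
  have hanti : Antitone fun S : Finset ℕ => (⋃ i, f i) \ ⋃ i ∈ S, f i := by
    intro S S' h
    refine Set.sdiff_subset_sdiff_right ?_
    exact Set.biUnion_subset_biUnion_left h
  have := tendsto_measure_iInter_atTop (μ := μ) (s := fun S : Finset ℕ => (⋃ i, f i) \ ⋃ i ∈ S, f i)
    (fun S => ((MeasurableSet.iUnion hf).diff
      (S.measurableSet_biUnion fun i _ => hf i)).nullMeasurableSet) hanti
    ⟨∅, measure_ne_top _ _⟩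
  have hempty : ⋂ S : Finset ℕ, (⋃ i, f i) \ ⋃ i ∈ S, f i = ∅ := by
    ext x
    simp only [Set.mem_iInter, Set.mem_sdiff, Set.mem_iUnion, Set.mem_empty_iff_false, iff_false]
    intro h
    obtain ⟨i, hi⟩ := (h ∅).1
    exact (h {i}).2 ⟨i, Finset.mem_singleton_self i, hi⟩
  rw [hempty, measure_empty] at this
  exact this

/-- The signed measure `s ↦ ℓ (1_s)` of a continuous linear functional on `L^r`. -/
noncomputable def functionalMeasure {r : ℝ≥0∞} [Fact (1 ≤ r)] (hr : r ≠ ∞)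
    (l : Lp ℝ r μ →L[ℝ] ℝ) : SignedMeasure α := by
  classical
  exact
  { measureOf' := fun s =>
      if h : MeasurableSet s then l (indicatorConstLp r h (measure_ne_top μ s) 1) else 0
    empty' := by simp [indicatorConstLp_empty]
    not_measurable' := fun s hs => by simp [hs]
    m_iUnion' := fun f hf hd => by
      simp only [hf, MeasurableSet.iUnion hf, dif_pos]
      exact (hasSum_indicatorConstLp hr hf hd).mapL l }

theorem functionalMeasure_apply {r : ℝ≥0∞} [Fact (1 ≤ r)] (hr : r ≠ ∞)
    (l : Lp ℝ r μ →L[ℝ] ℝ) {s : Set α} (hs : MeasurableSet s) :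
    functionalMeasure hr l s = l (indicatorConstLp r hs (measure_ne_top μ s) 1) :=
  dif_pos hs

/-- Radon–Nikodym: null sets have zero indicator in `L^r`, so the signed measure `s ↦ l 1_s` is
absolutely continuous, and `g` is its density. -/
theorem exists_integrable_functional_indicator {r : ℝ≥0∞} [Fact (1 ≤ r)] (hr : r ≠ ∞)
    (l : Lp ℝ r μ →L[ℝ] ℝ) :
    ∃ g : α → ℝ, Measurable g ∧ Integrable g μ ∧ ∀ (s : Set α) (hs : MeasurableSet s),
      l (indicatorConstLp r hs (measure_ne_top μ s) 1) = ∫ x in s, g x ∂μ := by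
  set ν := functionalMeasure hr l
  have hac : ν ≪ᵥ μ.toENNRealVectorMeasure := by
    intro s h
    by_cases hs : MeasurableSet s
    · rw [Measure.toENNRealVectorMeasure_apply_measurable hs] at h
      rw [functionalMeasure_apply hr l hs]
      have : indicatorConstLp r hs (measure_ne_top μ s) (1 : ℝ) = 0 := by
        rw [← norm_eq_zero, norm_indicatorConstLp (zero_lt_one.trans_le Fact.out).ne' hr]
        have h1 : 1 / r.toReal ≠ 0 := one_div_ne_zero
          (ENNReal.toReal_pos (zero_lt_one.trans_le Fact.out).ne' hr).ne'
        simp [Measure.real, h, -one_div, Real.zero_rpow h1]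
      rw [this, map_zero]
    · exact ν.not_measurable hs
  have hν := (ν.absolutelyContinuous_iff_withDensityᵥ_rnDeriv_eq μ).1 hac
  refine ⟨ν.rnDeriv μ, ν.measurable_rnDeriv μ, ν.integrable_rnDeriv μ, fun s hs => ?_⟩
  rw [← functionalMeasure_apply hr l hs, ← withDensityᵥ_apply (ν.integrable_rnDeriv μ) hs, hν]

theorem functional_simpleFunc_eq_integral {r : ℝ≥0∞} [Fact (1 ≤ r)] {l : Lp ℝ r μ →L[ℝ] ℝ}
    {g : α → ℝ} (hg : Integrable g μ)
    (h : ∀ (s : Set α) (hs : MeasurableSet s),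
      l (indicatorConstLp r hs (measure_ne_top μ s) 1) = ∫ x in s, g x ∂μ)
    (φ : SimpleFunc α ℝ) :
    l ((φ.memLp_of_isFiniteMeasure r μ).toLp φ) = ∫ x, φ x * g x ∂μ := by
  have hint : ∀ φ : SimpleFunc α ℝ, Integrable (fun x => φ x * g x) μ := fun φ => by
    obtain ⟨C, hC⟩ := φ.exists_forall_norm_le
    exact hg.bdd_mul φ.measurable.aestronglyMeasurable (Eventually.of_forall hC)
  induction φ using SimpleFunc.induction with
  | const c hs =>
    rename_i s
    have h1 : ((SimpleFunc.memLp_of_isFiniteMeasure (SimpleFunc.piecewise s hs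
        (SimpleFunc.const α c) (SimpleFunc.const α 0)) r μ).toLp _ : Lp ℝ r μ) =
        c • indicatorConstLp r hs (measure_ne_top μ s) (1 : ℝ) := by
      rw [indicatorConstLp, ← MemLp.toLp_const_smul]
      congr 1
      ext x
      by_cases hx : x ∈ s <;> simp [hx]
    rw [h1, map_smul, h, smul_eq_mul, ← integral_const_mul, ← integral_indicator hs]
    congr 1
    ext x
    by_cases hx : x ∈ s <;> simp [hx]
  | add hd hf hg' =>
    rename_i φ ψ
    have h1 : (((φ + ψ).memLp_of_isFiniteMeasure r μ).toLp _ : Lp ℝ r μ) =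
        (φ.memLp_of_isFiniteMeasure r μ).toLp φ + (ψ.memLp_of_isFiniteMeasure r μ).toLp ψ := rfl
    rw [h1, map_add, hf, hg', ← integral_add (hint _) (hint _)]
    congr 1
    ext x
    simp [add_mul]

/-- Test `l` with `φ = sgn(g) a^(q-1)`. Since `(q-1)p = q`, its `L^p` norm is `(∫ a^q)^(1/p)`,
whence `∫ a^q ≤ ‖l‖ (∫ a^q)^(1/p)`. Taking a simple `a` below `|g|` instead of `|g|` itself makes
the integral finite, so that one may divide. -/
theorem integral_rpow_le_of_functional {p q : ℝ} (hpq : p.HolderConjugate q)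
    [Fact (1 ≤ ENNReal.ofReal p)] {l : Lp ℝ (ENNReal.ofReal p) μ →L[ℝ] ℝ}
    {g : α → ℝ} (hgm : Measurable g) (hg : Integrable g μ)
    (h : ∀ (s : Set α) (hs : MeasurableSet s),
      l (indicatorConstLp _ hs (measure_ne_top μ s) 1) = ∫ x in s, g x ∂μ)
    (a : SimpleFunc α ℝ) (ha0 : ∀ x, 0 ≤ a x) (hag : ∀ x, a x ≤ |g x|) :
    ∫ x, a x ^ q ∂μ ≤ ‖l‖ ^ q := by
  have hs : MeasurableSet {x | 0 ≤ g x} := measurableSet_le measurable_const hgm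
  set φ : SimpleFunc α ℝ := SimpleFunc.piecewise {x | 0 ≤ g x} hs
    (a.map fun t => t ^ (q - 1)) (a.map fun t => -(t ^ (q - 1))) with hφ
  have hint : ∀ ψ : SimpleFunc α ℝ, Integrable ψ μ := fun ψ =>
    memLp_one_iff_integrable.1 (ψ.memLp_of_isFiniteMeasure 1 μ)
  have hφg : ∀ x, φ x * g x = a x ^ (q - 1) * |g x| := by
    intro x
    by_cases hx : 0 ≤ g x
    · simp [hφ, SimpleFunc.piecewise_apply, hx, abs_of_nonneg hx]
    · simp [hφ, SimpleFunc.piecewise_apply, hx, abs_of_neg (not_le.1 hx)]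
  have hφn : ∀ x, ‖φ x‖ ^ p = a x ^ q := by
    intro x
    have h1 : ‖φ x‖ = a x ^ (q - 1) := by
      have := Real.rpow_nonneg (ha0 x) (q - 1)
      by_cases hx : 0 ≤ g x <;> simp [hφ, SimpleFunc.piecewise_apply, hx, abs_of_nonneg this]
    rw [h1, ← Real.rpow_mul (ha0 x), hpq.symm.sub_one_mul_conj]
  have hq := hpq.symm.lt
  have hA0 : 0 ≤ ∫ x, a x ^ q ∂μ := integral_nonneg fun x => Real.rpow_nonneg (ha0 x) q
  have hle : ∫ x, a x ^ q ∂μ ≤ ‖l‖ * (∫ x, a x ^ q ∂μ) ^ (1 / p) := by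
    calc ∫ x, a x ^ q ∂μ ≤ ∫ x, φ x * g x ∂μ := by
          refine integral_mono (hint (a.map fun t => t ^ q)) ?_ fun x => ?_
          · obtain ⟨C, hC⟩ := φ.exists_forall_norm_le
            exact hg.bdd_mul φ.measurable.aestronglyMeasurable (Eventually.of_forall hC)
          · dsimp only
            rw [hφg]
            calc a x ^ q = a x ^ (q - 1) * a x := by
                  rcases (ha0 x).eq_or_lt with h0 | h0
                  · rw [← h0, mul_zero, Real.zero_rpow (by linarith)]
                  · rw [← Real.rpow_add_one h0.ne']; congr 1; ring
              _ ≤ _ := mul_le_mul_of_nonneg_left (hag x) (Real.rpow_nonneg (ha0 x) _)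
      _ = l ((φ.memLp_of_isFiniteMeasure _ μ).toLp φ) :=
          (functional_simpleFunc_eq_integral hg h φ).symm
      _ ≤ ‖l‖ * ‖(φ.memLp_of_isFiniteMeasure (ENNReal.ofReal p) μ).toLp φ‖ :=
          (le_abs_self _).trans (l.le_opNorm _)
      _ = ‖l‖ * (∫ x, a x ^ q ∂μ) ^ (1 / p) := by
          rw [Lp.norm_toLp, (φ.memLp_of_isFiniteMeasure _ μ).eLpNorm_eq_integral_rpow_norm
            (by simpa using hpq.pos) ENNReal.ofReal_ne_top, ENNReal.toReal_ofReal hpq.nonneg]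
          simp only [hφn]
          rw [ENNReal.toReal_ofReal (by positivity), one_div]
  rcases hA0.eq_or_lt with h0 | h0
  · rw [← h0]; positivity
  · have h1 : (∫ x, a x ^ q ∂μ) ^ (1 / q) ≤ ‖l‖ := by
      have h2 : (1 : ℝ) / q = 1 - 1 / p := by
        have := hpq.inv_add_inv_eq_one
        rw [one_div, one_div]; linarith
      rw [h2, Real.rpow_sub h0, Real.rpow_one, div_le_iff₀ (by positivity)]
      exact hle
    calc ∫ x, a x ^ q ∂μ = ((∫ x, a x ^ q ∂μ) ^ (1 / q)) ^ q := by
          rw [← Real.rpow_mul hA0, one_div_mul_cancel (by linarith), Real.rpow_one]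
      _ ≤ _ := Real.rpow_le_rpow (by positivity) h1 (by linarith)

/-- Simple functions increasing to `|g|` obey a bound that does not depend on them; Fatou's lemma
passes it to the limit. -/
theorem memLp_of_functional {p q : ℝ} (hpq : p.HolderConjugate q)
    [Fact (1 ≤ ENNReal.ofReal p)] {l : Lp ℝ (ENNReal.ofReal p) μ →L[ℝ] ℝ}
    {g : α → ℝ} (hgm : Measurable g) (hg : Integrable g μ)
    (h : ∀ (s : Set α) (hs : MeasurableSet s),
      l (indicatorConstLp _ hs (measure_ne_top μ s) 1) = ∫ x in s, g x ∂μ) :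
    MemLp g (ENNReal.ofReal q) μ := by
  have hq := hpq.symm.pos
  set f : α → ℝ≥0∞ := fun x => ‖g x‖ₑ
  have hf : Measurable f := hgm.enorm
  have hbound : ∀ n, ∫⁻ x, SimpleFunc.eapprox f n x ^ q ∂μ ≤ ENNReal.ofReal (‖l‖ ^ q) := by
    intro n
    have hfin : ∀ x, SimpleFunc.eapprox f n x ≠ ∞ := fun x => (SimpleFunc.eapprox_lt_top f n x).ne
    set a : SimpleFunc α ℝ := (SimpleFunc.eapprox f n).map ENNReal.toReal
    have hle : ∀ x, SimpleFunc.eapprox f n x ≤ f x := fun x => by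
      rw [← SimpleFunc.iSup_eapprox_apply hf x]
      exact le_iSup (fun k => SimpleFunc.eapprox f k x) n
    have := integral_rpow_le_of_functional hpq hgm hg h a (fun x => ENNReal.toReal_nonneg)
      (fun x => by
        have := ENNReal.toReal_mono enorm_ne_top (hle x)
        simpa [f, a] using this)
    have hint : Integrable (fun x => a x ^ q) μ :=
      memLp_one_iff_integrable.1 ((a.map fun t => t ^ q).memLp_of_isFiniteMeasure 1 μ)
    calc ∫⁻ x, SimpleFunc.eapprox f n x ^ q ∂μ = ∫⁻ x, ENNReal.ofReal (a x ^ q) ∂μ := by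
          refine lintegral_congr fun x => ?_
          change _ = ENNReal.ofReal ((SimpleFunc.eapprox f n x).toReal ^ q)
          rw [← ENNReal.ofReal_rpow_of_nonneg ENNReal.toReal_nonneg hq.le,
            ENNReal.ofReal_toReal (hfin x)]
      _ = ENNReal.ofReal (∫ x, a x ^ q ∂μ) :=
          (ofReal_integral_eq_lintegral_ofReal hint
            (Eventually.of_forall fun x => Real.rpow_nonneg ENNReal.toReal_nonneg q)).symm
      _ ≤ _ := ENNReal.ofReal_le_ofReal this
  refine ⟨hgm.aestronglyMeasurable, ?_⟩
  rw [eLpNorm_lt_top_iff_lintegral_rpow_enorm_lt_top (by simpa using hq) ENNReal.ofReal_ne_top,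
    ENNReal.toReal_ofReal hq.le]
  refine lt_of_le_of_lt ?_ (ENNReal.ofReal_lt_top (r := ‖l‖ ^ q))
  have htend : ∀ x, Tendsto (fun n => SimpleFunc.eapprox f n x ^ q) atTop (𝓝 (f x ^ q)) := by
    intro x
    refine (ENNReal.continuous_rpow_const.tendsto _).comp ?_
    rw [← SimpleFunc.iSup_eapprox_apply hf x]
    exact tendsto_atTop_iSup fun i j hij => SimpleFunc.monotone_eapprox f hij x
  calc ∫⁻ x, f x ^ q ∂μ
      = ∫⁻ x, liminf (fun n => SimpleFunc.eapprox f n x ^ q) atTop ∂μ :=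
        lintegral_congr fun x => (htend x).liminf_eq.symm
    _ ≤ liminf (fun n => ∫⁻ x, SimpleFunc.eapprox f n x ^ q ∂μ) atTop :=
        lintegral_liminf_le fun n => (SimpleFunc.eapprox f n).measurable.pow_const q
    _ ≤ _ := liminf_le_of_le (by isBoundedDefault) fun b hb => by
        obtain ⟨n, hn⟩ := hb.exists
        exact hn.trans (hbound n)

/-- **Riesz representation** of the dual of `L^p` over a finite measure, for `1 < p < ∞`. -/
theorem exists_lp_representation {p q : ℝ} (hpq : p.HolderConjugate q)
    [Fact (1 ≤ ENNReal.ofReal p)] (l : Lp ℝ (ENNReal.ofReal p) μ →L[ℝ] ℝ) :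
    ∃ g : Lp ℝ (ENNReal.ofReal q) μ, ∀ f : Lp ℝ (ENNReal.ofReal p) μ,
      l f = ∫ x, f x * g x ∂μ := by
  obtain ⟨g, hgm, hg, h⟩ := exists_integrable_functional_indicator ENNReal.ofReal_ne_top l
  have hgL := memLp_of_functional hpq hgm hg h
  have hconj : (ENNReal.ofReal p).HolderConjugate (ENNReal.ofReal q) := hpq.ennrealOfReal
  have : Fact (1 ≤ ENNReal.ofReal q) :=
    ⟨by rw [← ENNReal.ofReal_one]; exact ENNReal.ofReal_le_ofReal hpq.symm.lt.le⟩
  set G : Lp ℝ (ENNReal.ofReal q) μ := hgL.toLp g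
  set B := (ContinuousLinearMap.mul ℝ ℝ).lpPairing μ (ENNReal.ofReal p) (ENNReal.ofReal q)
  have hB : ∀ f, B f G = ∫ x, f x * G x ∂μ := fun f => by
    simp only [B, ContinuousLinearMap.lpPairing_eq_integral, ContinuousLinearMap.mul_apply']
  refine ⟨G, fun f => ?_⟩
  rw [← hB]
  -- Both sides are continuous and additive in `f`, so it suffices to compare them on indicators.
  refine Lp.induction ENNReal.ofReal_ne_top (motive := fun f => l f = B f G) ?_ ?_ ?_ f
  · intro c s hs hμs
    have h1 : (Lp.simpleFunc.indicatorConst (ENNReal.ofReal p) hs hμs.ne c :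
        Lp ℝ (ENNReal.ofReal p) μ) = c • indicatorConstLp _ hs hμs.ne (1 : ℝ) := by
      rw [Lp.simpleFunc.coe_indicatorConst, indicatorConstLp, indicatorConstLp,
        ← MemLp.toLp_const_smul]
      congr 1
      ext x
      by_cases hx : x ∈ s <;> simp [hx]
    rw [h1, map_smul, map_smul, smul_apply, h, hB]
    congr 1
    rw [← integral_indicator hs]
    refine integral_congr_ae ?_
    filter_upwards [indicatorConstLp_coeFn (p := ENNReal.ofReal p) (hs := hs) (hμs := hμs.ne)
      (c := (1 : ℝ)), hgL.coeFn_toLp] with x hx1 hx2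
    rw [hx1, hx2]
    by_cases hx : x ∈ s <;> simp [hx]
  · intro f f' hf hf' _ h1 h2
    rw [map_add, map_add, add_apply, h1, h2]
  · exact isClosed_eq l.continuous (B.flip G).continuous

/-- Bounded sequences in `L^p`, `1 < p < ∞`, have weakly convergent subsequences. -/
theorem exists_weakly_convergent_subseq [MeasurableSpace.CountablyGenerated α] {p : ℝ}
    (hp : 1 < p) [Fact (1 ≤ ENNReal.ofReal p)] {f : ℕ → Lp ℝ (ENNReal.ofReal p) μ} {C : ℝ}
    (hf : ∀ n, ‖f n‖ ≤ C) :
    ∃ φ : ℕ → ℕ, StrictMono φ ∧ ∃ v : Lp ℝ (ENNReal.ofReal p) μ,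
      ∀ l : Lp ℝ (ENNReal.ofReal p) μ →L[ℝ] ℝ, Tendsto (fun k => l (f (φ k))) atTop (𝓝 (l v)) := by
  set q := p.conjExponent
  have hpq : p.HolderConjugate q := Real.HolderConjugate.conjExponent hp
  have hconj : (ENNReal.ofReal p).HolderConjugate (ENNReal.ofReal q) := hpq.ennrealOfReal
  have : Fact (1 ≤ ENNReal.ofReal q) :=
    ⟨by rw [← ENNReal.ofReal_one]; exact ENNReal.ofReal_le_ofReal hpq.symm.lt.le⟩
  have : Fact (ENNReal.ofReal q ≠ ∞) := ⟨ENNReal.ofReal_ne_top⟩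
  set B := (ContinuousLinearMap.mul ℝ ℝ).lpPairing μ (ENNReal.ofReal p) (ENNReal.ofReal q)
  have hB : ∀ f g, B f g = ∫ x, f x * g x ∂μ := fun f g => by
    simp only [B, ContinuousLinearMap.lpPairing_eq_integral, ContinuousLinearMap.mul_apply']
  have hmem : ∀ n, StrongDual.toWeakDual (B (f n)) ∈
      WeakDual.toStrongDual ⁻¹' Metric.closedBall (0 : StrongDual ℝ (Lp ℝ (ENNReal.ofReal q) μ))
        (‖B‖ * C) := by
    intro n
    change B (f n) ∈ Metric.closedBall _ _
    rw [mem_closedBall_zero_iff]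
    exact (B.le_opNorm _).trans (mul_le_mul_of_nonneg_left (hf n) (norm_nonneg _))
  -- Each `f n` is viewed as a functional on `L^q`. That space is separable, as the σ-algebra is
  -- countably generated and `q < ∞`, so sequential Banach–Alaoglu applies; representing the limit
  -- functional brings it back to `L^p`.
  obtain ⟨L, -, φ, hφ, hL⟩ :=
    WeakDual.isSeqCompact_closedBall ℝ (Lp ℝ (ENNReal.ofReal q) μ) 0 (‖B‖ * C) hmem
  obtain ⟨v, hv⟩ := exists_lp_representation hpq.symm (WeakDual.toStrongDual L)
  refine ⟨φ, hφ, v, fun l => ?_⟩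
  obtain ⟨g, hg⟩ := exists_lp_representation hpq l
  have hLg : Tendsto (fun k => B (f (φ k)) g) atTop (𝓝 (L g)) :=
    ((WeakDual.eval_continuous g).tendsto L).comp hL
  have h1 : L g = ∫ x, g x * v x ∂μ := hv g
  simp only [hg]
  simp only [hB, h1] at hLg
  simpa only [mul_comm] using hLg

end LpDuality

/-! ### The lattice `T ℤ^d`, and averaging over translates of the cell. -/

section Periodicity

variable {d : ℕ} {T : ℝ}

/-- The basis `T e_1, …, T e_d` of `ℝ^d`. -/
noncomputable def latticeBasis (d : ℕ) (hT : 0 < T) :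
    Module.Basis (Fin d) ℝ (EuclideanSpace ℝ (Fin d)) :=
  (EuclideanSpace.basisFun (Fin d) ℝ).toBasis.isUnitSMul fun _ => (isUnit_iff_ne_zero.2 hT.ne')

theorem latticeBasis_apply (hT : 0 < T) (i : Fin d) :
    latticeBasis d hT i = T • EuclideanSpace.single i (1 : ℝ) := by
  simp [latticeBasis, Module.Basis.isUnitSMul_apply]

theorem latticeBasis_repr (hT : 0 < T) (x : EuclideanSpace ℝ (Fin d)) (i : Fin d) :
    (latticeBasis d hT).repr x i = T⁻¹ * x i := by
  rw [latticeBasis, Module.Basis.repr_isUnitSMul, Units.smul_def]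
  simp

/-- The lattice `T ℤ^d`. -/
noncomputable abbrev lattice (d : ℕ) (hT : 0 < T) : AddSubgroup (EuclideanSpace ℝ (Fin d)) :=
  (Submodule.span ℤ (Set.range (latticeBasis d hT))).toAddSubgroup

instance instCountableLattice (hT : 0 < T) : Countable (lattice d hT) :=
  inferInstanceAs (Countable (Submodule.span ℤ (Set.range (latticeBasis d hT))))

theorem mem_fundamentalDomain_latticeBasis (hT : 0 < T) {x : EuclideanSpace ℝ (Fin d)} :
    x ∈ ZSpan.fundamentalDomain (latticeBasis d hT) ↔ ∀ i, x i ∈ Set.Ico 0 T := by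
  rw [ZSpan.mem_fundamentalDomain]
  refine forall_congr' fun i => ?_
  rw [latticeBasis_repr, Set.mem_Ico, Set.mem_Ico, inv_mul_lt_iff₀ hT, mul_one,
    mul_nonneg_iff_of_pos_left (inv_pos.2 hT)]

theorem measurableSet_cell (d : ℕ) (T : ℝ) : MeasurableSet (cell d T) := by
  have : cell d T = ⋂ i, {x : EuclideanSpace ℝ (Fin d) | x i ∈ Set.Icc 0 T} := by
    ext x; simp [cell]
  rw [this]
  refine MeasurableSet.iInter fun i => ?_
  have h : Measurable fun x : EuclideanSpace ℝ (Fin d) => x i := by fun_prop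
  exact h measurableSet_Icc

theorem cell_eq_preimage (d : ℕ) (T : ℝ) :
    cell d T = (MeasurableEquiv.toLp 2 (Fin d → ℝ)).symm ⁻¹' Set.Icc 0 (fun _ => T) := by
  ext x
  simp only [cell, Set.mem_ofPred_eq, Set.mem_preimage, Set.mem_Icc, Pi.le_def]
  exact forall_and

theorem volume_cell (d : ℕ) {T : ℝ} (hT : 0 < T) : volume (cell d T) = ENNReal.ofReal (T ^ d) := by
  rw [cell_eq_preimage, (EuclideanSpace.volume_preserving_symm_measurableEquiv_toLp
    (Fin d)).measure_preimage_equiv, Real.volume_Icc_pi]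
  simp [ENNReal.ofReal_pow hT.le]

theorem fundamentalDomain_ae_eq_cell (hT : 0 < T) :
    (ZSpan.fundamentalDomain (latticeBasis d hT) : Set (EuclideanSpace ℝ (Fin d)))
      =ᵐ[volume] cell d T := by
  have h1 : ZSpan.fundamentalDomain (latticeBasis d hT) =
      (MeasurableEquiv.toLp 2 (Fin d → ℝ)).symm ⁻¹'
        (Set.univ.pi fun _ => Set.Ico 0 T) := by
    ext x
    rw [mem_fundamentalDomain_latticeBasis]
    simp
  rw [h1, cell_eq_preimage]
  refine (EuclideanSpace.volume_preserving_symm_measurableEquiv_toLp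
    (Fin d)).quasiMeasurePreserving.preimage_ae_eq ?_
  exact Measure.univ_pi_Ico_ae_eq_Icc

/-- The exceptional set can be chosen common to all translations because the lattice is countable.
For a single lattice vector one inducts from the generators, as translations preserve null sets. -/
theorem ae_periodic_lattice {β : Type*} (hT : 0 < T) {φ : EuclideanSpace ℝ (Fin d) → β}
    (hφ : ∀ i : Fin d, ∀ᵐ x, φ (x + T • EuclideanSpace.single i (1 : ℝ)) = φ x) :
    ∀ᵐ x, ∀ g : lattice d hT, φ (g +ᵥ x) = φ x := by
  rw [ae_all_iff]
  rintro ⟨g, hg⟩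
  change ∀ᵐ x, φ (g + x) = φ x
  have hg' : g ∈ Submodule.span ℤ (Set.range (latticeBasis d hT)) := hg
  clear hg
  induction hg' using Submodule.span_induction with
  | mem g hg =>
    obtain ⟨i, rfl⟩ := hg
    filter_upwards [hφ i] with x hx
    rw [latticeBasis_apply, add_comm, hx]
  | zero => simp
  | add g g' _ _ hg hg' =>
    filter_upwards [hg', (quasiMeasurePreserving_add_left volume g').ae hg] with x h1 h2
    rw [add_assoc, h2, h1]
  | smul n g _ hg =>
    have hneg : ∀ᵐ x, φ (-g + x) = φ x := by
      filter_upwards [(quasiMeasurePreserving_add_left volume (-g)).ae hg] with x hx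
      rw [← hx, add_neg_cancel_left]
    have hnat : ∀ (k : ℕ) (h : EuclideanSpace ℝ (Fin d)), (∀ᵐ x, φ (h + x) = φ x) →
        ∀ᵐ x, φ (k • h + x) = φ x := by
      intro k h hh
      induction k with
      | zero => simp
      | succ k ih =>
        filter_upwards [hh, (quasiMeasurePreserving_add_left volume h).ae ih] with x h1 h2
        rw [succ_nsmul, add_assoc, h2, h1]
    obtain ⟨k, rfl | rfl⟩ := n.eq_nat_or_neg
    · simpa using hnat k g hg
    · simpa using hnat k (-g) hneg

/-- The integral of a periodic function does not depend on the position of the cell. -/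
theorem setLIntegral_translate_cell (hT : 0 < T) {φ : EuclideanSpace ℝ (Fin d) → ℝ≥0∞}
    (hφ : ∀ i : Fin d, ∀ᵐ x, φ (x + T • EuclideanSpace.single i (1 : ℝ)) = φ x)
    (w : EuclideanSpace ℝ (Fin d)) :
    ∫⁻ y in {y | y - w ∈ cell d T}, φ y = ∫⁻ y in cell d T, φ y := by
  classical
  have hae := ae_periodic_lattice hT hφ
  -- The comparison of fundamental domains needs invariance at every point. Setting `φ` to zero
  -- where it fails to be invariant yields such a function in the same almost everywhere class.
  set φ' : EuclideanSpace ℝ (Fin d) → ℝ≥0∞ := fun x =>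
    if ∀ g : lattice d hT, φ (g +ᵥ x) = φ x then φ x else 0 with hφ'
  have hφφ' : φ =ᵐ[volume] φ' := by
    filter_upwards [hae] with x hx
    rw [hφ']
    simp only [hx, implies_true, if_true]
  have hinv : ∀ (g : lattice d hT) (x), φ' (g +ᵥ x) = φ' x := by
    have key : ∀ (g : lattice d hT) (x), (∀ h : lattice d hT, φ (h +ᵥ x) = φ x) →
        ∀ h : lattice d hT, φ (h +ᵥ (g +ᵥ x)) = φ (g +ᵥ x) := by
      intro g x h k
      rw [vadd_vadd, h, h]
    intro g x
    simp only [hφ']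
    by_cases h : ∀ k : lattice d hT, φ (k +ᵥ x) = φ x
    · rw [if_pos h, if_pos (key g x h), h]
    · rw [if_neg h, if_neg]
      intro h'
      apply h
      have := key (-g) (g +ᵥ x) h'
      rwa [neg_vadd_vadd] at this
  have hD := ZSpan.isAddFundamentalDomain' (latticeBasis d hT)
    (volume : Measure (EuclideanSpace ℝ (Fin d)))
  have hD' := hD.vadd_of_comm w
  have heq : ((w +ᵥ ZSpan.fundamentalDomain (latticeBasis d hT) :
      Set (EuclideanSpace ℝ (Fin d)))) =ᵐ[volume] {y | y - w ∈ cell d T} := by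
    have h1 : (w +ᵥ ZSpan.fundamentalDomain (latticeBasis d hT) :
        Set (EuclideanSpace ℝ (Fin d))) =
        (fun y => y - w) ⁻¹' ZSpan.fundamentalDomain (latticeBasis d hT) := by
      ext y
      rw [Set.mem_vadd_set_iff_neg_vadd_mem, Set.mem_preimage, vadd_eq_add, neg_add_eq_sub]
    rw [h1]
    exact (measurePreserving_sub_right volume w).quasiMeasurePreserving.preimage_ae_eq
      (fundamentalDomain_ae_eq_cell hT)
  calc ∫⁻ y in {y | y - w ∈ cell d T}, φ y
      = ∫⁻ y in {y | y - w ∈ cell d T}, φ' y := lintegral_congr_ae (ae_restrict_of_ae hφφ')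
    _ = ∫⁻ y in (w +ᵥ ZSpan.fundamentalDomain (latticeBasis d hT) :
          Set (EuclideanSpace ℝ (Fin d))), φ' y := (setLIntegral_congr heq).symm
    _ = ∫⁻ y in ZSpan.fundamentalDomain (latticeBasis d hT), φ' y := hD'.setLIntegral_eq hD φ' hinv
    _ = ∫⁻ y in cell d T, φ' y := setLIntegral_congr (fundamentalDomain_ae_eq_cell hT)
    _ = ∫⁻ y in cell d T, φ y := (lintegral_congr_ae (ae_restrict_of_ae hφφ')).symm

theorem volume_setOf_sub_mem_cell (hT : 0 < T) (y : EuclideanSpace ℝ (Fin d)) :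
    volume {w | y - w ∈ cell d T} = ENNReal.ofReal (T ^ d) := by
  rw [← volume_cell d hT]
  exact (Measure.measurePreserving_sub_left volume y).measure_preimage
    (measurableSet_cell d T).nullMeasurableSet

theorem measurableSet_sub_mem_cell (d : ℕ) (T : ℝ) :
    MeasurableSet {z : EuclideanSpace ℝ (Fin d) × EuclideanSpace ℝ (Fin d) |
      z.2 - z.1 ∈ cell d T} := by
  have h : Measurable fun z : EuclideanSpace ℝ (Fin d) × EuclideanSpace ℝ (Fin d) => z.2 - z.1 := by
    fun_prop
  exact h (measurableSet_cell d T)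

/-- Averaging a weight `G` over cells turns the integral of a periodic function against the
averaged weight into a product of integrals. -/
theorem lintegral_mul_lintegral_cell_average (hT : 0 < T) {φ : EuclideanSpace ℝ (Fin d) → ℝ≥0∞}
    (hφm : AEMeasurable φ)
    (hφ : ∀ i : Fin d, ∀ᵐ x, φ (x + T • EuclideanSpace.single i (1 : ℝ)) = φ x)
    {G : EuclideanSpace ℝ (Fin d) → ℝ≥0∞} (hG : Measurable G) :
    ∫⁻ y, φ y * ∫⁻ w in {w | y - w ∈ cell d T}, G w =
      (∫⁻ y in cell d T, φ y) * ∫⁻ w, G w := by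
  have hS := measurableSet_sub_mem_cell d T
  have hSw : ∀ w : EuclideanSpace ℝ (Fin d), MeasurableSet {y | y - w ∈ cell d T} := fun w =>
    measurable_prodMk_left hS
  have hSy : ∀ y : EuclideanSpace ℝ (Fin d), MeasurableSet {w | y - w ∈ cell d T} := fun y =>
    measurable_prodMk_right hS
  set F : EuclideanSpace ℝ (Fin d) → EuclideanSpace ℝ (Fin d) → ℝ≥0∞ := fun w y =>
    {z : EuclideanSpace ℝ (Fin d) × EuclideanSpace ℝ (Fin d) | z.2 - z.1 ∈ cell d T}.indicator
      (fun z => φ z.2 * G z.1) (w, y) with hF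
  have hFm : AEMeasurable (Function.uncurry F) (volume.prod volume) := by
    have : Function.uncurry F =
        {z : EuclideanSpace ℝ (Fin d) × EuclideanSpace ℝ (Fin d) |
          z.2 - z.1 ∈ cell d T}.indicator (fun z => φ z.2 * G z.1) := by
      ext ⟨w, y⟩; rfl
    rw [this]
    exact (hφm.comp_snd.mul (hG.comp measurable_fst).aemeasurable).indicator hS
  -- Tonelli on `{(w, y) | y - w ∈ Q_T}`: for fixed `w` the slice in `y` is the translated cell `w +
  -- Q_T`, on which `φ` has the same integral as on `Q_T`.
  calc ∫⁻ y, φ y * ∫⁻ w in {w | y - w ∈ cell d T}, G w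
      = ∫⁻ y, ∫⁻ w, F w y := by
        refine lintegral_congr fun y => ?_
        rw [← lintegral_indicator (hSy y), ← lintegral_const_mul _ (hG.indicator (hSy y))]
        refine lintegral_congr fun w => ?_
        by_cases h : y - w ∈ cell d T <;> simp [hF, h]
    _ = ∫⁻ w, ∫⁻ y, F w y := (lintegral_lintegral_swap hFm).symm
    _ = ∫⁻ w, (∫⁻ y in cell d T, φ y) * G w := by
        refine lintegral_congr fun w => ?_
        rw [← setLIntegral_translate_cell hT hφ w, ← lintegral_mul_const'' _ hφm.restrict,
          ← lintegral_indicator (hSw w)]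
        refine lintegral_congr fun y => ?_
        by_cases h : y - w ∈ cell d T <;> simp [hF, h]
    _ = _ := lintegral_const_mul _ hG

/-- The mean of `G` over `{w | y - w ∈ Q_T}`, a set of volume `T^d`, is at most `g y`. With `g` the
fractional kernel and `G` a smaller radial one, this bounds the inner energy integral from below;
the next lemma is its mirror image. -/
theorem lintegral_cell_mul_lintegral_le (hT : 0 < T) {φ : EuclideanSpace ℝ (Fin d) → ℝ≥0∞}
    (hφm : AEMeasurable φ)
    (hφ : ∀ i : Fin d, ∀ᵐ x, φ (x + T • EuclideanSpace.single i (1 : ℝ)) = φ x)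
    {G g : EuclideanSpace ℝ (Fin d) → ℝ≥0∞} (hG : Measurable G)
    (hGg : ∀ w y, y - w ∈ cell d T → G w ≤ g y) :
    (∫⁻ y in cell d T, φ y) * ∫⁻ w, G w ≤ ENNReal.ofReal (T ^ d) * ∫⁻ y, φ y * g y := by
  rw [← lintegral_mul_lintegral_cell_average hT hφm hφ hG,
    ← lintegral_const_mul' _ _ ENNReal.ofReal_ne_top]
  refine lintegral_mono fun y => ?_
  calc φ y * ∫⁻ w in {w | y - w ∈ cell d T}, G w
      ≤ φ y * ∫⁻ _ in {w | y - w ∈ cell d T}, g y := by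
        exact mul_le_mul' le_rfl (setLIntegral_mono measurable_const fun w hw => hGg w y hw)
    _ = ENNReal.ofReal (T ^ d) * (φ y * g y) := by
        rw [setLIntegral_const, volume_setOf_sub_mem_cell hT]
        ring

theorem lintegral_mul_le_lintegral_cell_mul (hT : 0 < T) {φ : EuclideanSpace ℝ (Fin d) → ℝ≥0∞}
    (hφm : AEMeasurable φ)
    (hφ : ∀ i : Fin d, ∀ᵐ x, φ (x + T • EuclideanSpace.single i (1 : ℝ)) = φ x)
    {G g : EuclideanSpace ℝ (Fin d) → ℝ≥0∞} (hG : Measurable G)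
    (hGg : ∀ w y, y - w ∈ cell d T → g y ≤ G w) :
    ENNReal.ofReal (T ^ d) * ∫⁻ y, φ y * g y ≤ (∫⁻ y in cell d T, φ y) * ∫⁻ w, G w := by
  rw [← lintegral_mul_lintegral_cell_average hT hφm hφ hG,
    ← lintegral_const_mul' _ _ ENNReal.ofReal_ne_top]
  refine lintegral_mono fun y => ?_
  calc ENNReal.ofReal (T ^ d) * (φ y * g y)
      = φ y * ∫⁻ _ in {w | y - w ∈ cell d T}, g y := by
        rw [setLIntegral_const, volume_setOf_sub_mem_cell hT]
        ring
    _ ≤ _ := by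
        exact mul_le_mul' le_rfl (setLIntegral_mono hG fun w hw => hGg w y hw)

theorem norm_le_of_mem_cell (hT : 0 < T) {x : EuclideanSpace ℝ (Fin d)} (hx : x ∈ cell d T) :
    ‖x‖ ≤ T * √d := by
  rw [EuclideanSpace.norm_eq]
  calc √(∑ i, ‖x i‖ ^ 2) ≤ √(∑ _i : Fin d, T ^ 2) := by
        refine Real.sqrt_le_sqrt (Finset.sum_le_sum fun i _ => ?_)
        rw [Real.norm_of_nonneg (hx i).1]
        exact pow_le_pow_left₀ (hx i).1 (hx i).2 2
    _ = T * √d := by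
        rw [Finset.sum_const, Finset.card_univ, Fintype.card_fin, nsmul_eq_mul, mul_comm,
          Real.sqrt_mul (by positivity), Real.sqrt_sq hT.le]

end Periodicity

/-! ### Polar coordinates and the mass of truncated power kernels. -/

section Radial

variable {d : ℕ}

theorem unitBallVolume_nonneg (d : ℕ) : 0 ≤ unitBallVolume d := ENNReal.toReal_nonneg

/-- Integration of nonnegative radial functions in polar coordinates. -/
theorem lintegral_radial (hd : 1 ≤ d) {f : ℝ → ℝ} (hf : ∀ r, 0 ≤ f r)
    (hint : IntegrableOn (fun r => r ^ (d - 1) * f r) (Set.Ioi 0)) :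
    ∫⁻ w : EuclideanSpace ℝ (Fin d), ENNReal.ofReal (f ‖w‖) =
      ENNReal.ofReal (d * unitBallVolume d * ∫ r in Set.Ioi (0 : ℝ), r ^ (d - 1) * f r) := by
  have : Nonempty (Fin d) := ⟨⟨0, hd⟩⟩
  have h1 : Integrable (fun w : EuclideanSpace ℝ (Fin d) => f ‖w‖) := by
    rw [integrable_fun_norm_addHaar, finrank_euclideanSpace_fin]
    exact hint
  rw [← ofReal_integral_eq_lintegral_ofReal h1 (Eventually.of_forall fun w => hf _),
    integral_fun_norm_addHaar, finrank_euclideanSpace_fin, nsmul_eq_mul, smul_eq_mul, ← mul_assoc]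
  rfl

theorem pow_mul_one_div_rpow {d : ℕ} (hd : 1 ≤ d) {r e : ℝ} (hr : 0 < r) :
    r ^ (d - 1) * (1 / r ^ e) = r ^ (d - 1 - e) := by
  rw [Real.rpow_sub hr, ← Real.rpow_natCast, Nat.cast_sub hd, Nat.cast_one]
  ring

/-- With `a = s p`, the blow-up `1/a` is what the prefactor `s` compensates; it leaves `d ω_d / p`
in the limit. -/
theorem lintegral_norm_rpow_tail (hd : 1 ≤ d) {R a : ℝ} (hR : 0 < R) (ha : 0 < a) :
    ∫⁻ w : EuclideanSpace ℝ (Fin d), ENNReal.ofReal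
        ((Set.Ioi R).indicator (fun r => 1 / r ^ ((d : ℝ) + a)) ‖w‖) =
      ENNReal.ofReal (d * unitBallVolume d * (R ^ (-a) / a)) := by
  have heq : Set.EqOn (fun r : ℝ => r ^ (d - 1) *
      (Set.Ioi R).indicator (fun r => 1 / r ^ ((d : ℝ) + a)) r)
      ((Set.Ioi R).indicator fun r => r ^ (-1 - a)) (Set.Ioi 0) := by
    intro r hr
    by_cases h : r ∈ Set.Ioi R
    · simp only [Set.indicator_of_mem h]
      rw [pow_mul_one_div_rpow hd hr]
      congr 1; ring
    · simp only [Set.indicator_of_notMem h, mul_zero]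
  have hint := integrableOn_Ioi_rpow_of_lt (a := -1 - a) (by linarith) hR
  rw [lintegral_radial hd (f := (Set.Ioi R).indicator (fun r => 1 / r ^ ((d : ℝ) + a)))]
  · rw [setIntegral_congr_fun measurableSet_Ioi heq, setIntegral_indicator measurableSet_Ioi,
      Set.inter_eq_right.2 (Set.Ioi_subset_Ioi hR.le), integral_Ioi_rpow_of_lt (by linarith) hR]
    congr 2
    rw [show -1 - a + 1 = -a by ring, neg_div_neg_eq]
  · intro r
    refine Set.indicator_nonneg (fun r hr => ?_) r
    have : 0 < r := hR.trans hr
    positivity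
  · refine IntegrableOn.congr_fun ?_ heq.symm measurableSet_Ioi
    exact ((integrable_indicator_iff measurableSet_Ioi).2 hint).integrableOn

/-- Used with `b = p(1 - s)`: the Lipschitz bound gains `|x - y|^p` on the singularity, and the mass
stays bounded as `s → 0`. -/
theorem lintegral_norm_rpow_near (hd : 1 ≤ d) {R b : ℝ} (hR : 0 < R) (hb : 0 < b) :
    ∫⁻ w : EuclideanSpace ℝ (Fin d), ENNReal.ofReal
        ((Set.Ioc 0 R).indicator (fun r => 1 / r ^ ((d : ℝ) - b)) ‖w‖) =
      ENNReal.ofReal (d * unitBallVolume d * (R ^ b / b)) := by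
  have heq : Set.EqOn (fun r : ℝ => r ^ (d - 1) *
      (Set.Ioc 0 R).indicator (fun r => 1 / r ^ ((d : ℝ) - b)) r)
      ((Set.Ioc 0 R).indicator fun r => r ^ (b - 1)) (Set.Ioi 0) := by
    intro r hr
    by_cases h : r ∈ Set.Ioc 0 R
    · simp only [Set.indicator_of_mem h]
      rw [pow_mul_one_div_rpow hd hr]
      congr 1; ring
    · simp only [Set.indicator_of_notMem h, mul_zero]
  have hint : IntegrableOn (fun r : ℝ => r ^ (b - 1)) (Set.Ioc 0 R) :=
    (intervalIntegrable_iff_integrableOn_Ioc_of_le hR.le).1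
      (intervalIntegral.intervalIntegrable_rpow' (by linarith))
  rw [lintegral_radial hd (f := (Set.Ioc 0 R).indicator (fun r => 1 / r ^ ((d : ℝ) - b)))]
  · rw [setIntegral_congr_fun measurableSet_Ioi heq, setIntegral_indicator measurableSet_Ioc,
      Set.inter_eq_right.2 Set.Ioc_subset_Ioi_self, ← intervalIntegral.integral_of_le hR.le,
      integral_rpow (Or.inl (by linarith)), sub_add_cancel, Real.zero_rpow hb.ne', sub_zero]
  · intro r
    refine Set.indicator_nonneg (fun r hr => ?_) r
    have : 0 < r := hr.1
    positivity
  · refine IntegrableOn.congr_fun ?_ heq.symm measurableSet_Ioi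
    exact ((integrable_indicator_iff measurableSet_Ioc).2 hint).integrableOn

end Radial

/-! ### Two-sided comparison of `s F^s_p` with `F^0_p`. -/

section EnergyBounds

variable {d : ℕ} {T p : ℝ}

theorem aemeasurable_ofReal_abs_sub_rpow {u : EuclideanSpace ℝ (Fin d) → ℝ}
    (hu : AEStronglyMeasurable u) (c : ℝ) :
    AEMeasurable fun y => ENNReal.ofReal (|c - u y| ^ p) :=
  (((hu.aemeasurable.const_sub c).abs).pow_const p).ennreal_ofReal

theorem ae_periodic_ofReal_abs_sub_rpow (u : PerLp d T p) (c : ℝ) (i : Fin d) :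
    ∀ᵐ x, ENNReal.ofReal (|c - u (x + T • EuclideanSpace.single i (1 : ℝ))| ^ p) =
      ENNReal.ofReal (|c - u x| ^ p) := by
  filter_upwards [u.2.2.1 i] with x hx
  rw [hx]

/-- `T√d` is the diameter of the cell; at distance at least `R` an additive error of this size is a
factor `1 + T√d/R`. -/
theorem norm_sub_le_one_add_mul (hT : 0 < T) {R : ℝ} (hR : 0 < R)
    {x y w : EuclideanSpace ℝ (Fin d)} (hyw : y - w ∈ cell d T) (hw : R ≤ ‖x - w‖) :
    ‖x - y‖ ≤ (1 + T * √d / R) * ‖x - w‖ := by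
  have h1 : ‖x - y‖ ≤ ‖x - w‖ + ‖y - w‖ := by
    rw [show x - y = (x - w) - (y - w) by abel]; exact norm_sub_le _ _
  have h2 := norm_le_of_mem_cell hT hyw
  have h3 : T * √d ≤ T * √d / R * ‖x - w‖ := by
    rw [div_mul_eq_mul_div, le_div_iff₀ hR]
    exact mul_le_mul_of_nonneg_left hw (by positivity)
  linarith

theorem norm_sub_le_one_add_mul' (hT : 0 < T) {R : ℝ} (hR : 0 < R)
    {x y w : EuclideanSpace ℝ (Fin d)} (hyw : y - w ∈ cell d T) (hy : R ≤ ‖x - y‖) :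
    ‖x - w‖ ≤ (1 + T * √d / R) * ‖x - y‖ := by
  have h1 : ‖x - w‖ ≤ ‖x - y‖ + ‖y - w‖ := by
    rw [show x - w = (x - y) + (y - w) by abel]; exact norm_add_le _ _
  have h2 := norm_le_of_mem_cell hT hyw
  have h3 : T * √d ≤ T * √d / R * ‖x - y‖ := by
    rw [div_mul_eq_mul_div, le_div_iff₀ hR]
    exact mul_le_mul_of_nonneg_left hy (by positivity)
  linarith

theorem measurable_tail_kernel (R e : ℝ) (x : EuclideanSpace ℝ (Fin d)) :
    Measurable fun w => ENNReal.ofReal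
      ((Set.Ioi R).indicator (fun r => 1 / r ^ e) ‖x - w‖) := by
  have h : Measurable ((Set.Ioi R).indicator fun r : ℝ => 1 / r ^ e) :=
    (measurable_const.div (measurable_id.pow_const e)).indicator measurableSet_Ioi
  exact (h.comp (by fun_prop : Measurable fun w => ‖x - w‖)).ennreal_ofReal

theorem lintegral_tail_kernel (hd : 1 ≤ d) {R a : ℝ} (hR : 0 < R) (ha : 0 < a)
    (x : EuclideanSpace ℝ (Fin d)) :
    ∫⁻ w, ENNReal.ofReal ((Set.Ioi R).indicator (fun r => 1 / r ^ ((d : ℝ) + a)) ‖x - w‖) =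
      ENNReal.ofReal (d * unitBallVolume d * (R ^ (-a) / a)) := by
  rw [← lintegral_norm_rpow_tail hd hR ha]
  exact lintegral_sub_left_eq_self (fun w => ENNReal.ofReal
    ((Set.Ioi R).indicator (fun r => 1 / r ^ ((d : ℝ) + a)) ‖w‖)) x

/-- The constant in the lower bound of the fractional energies by `F_p^0`. -/
noncomputable def lowerConst (d : ℕ) (T p R s : ℝ) : ℝ :=
  (1 + T * √d / R) ^ (-((d : ℝ) + s * p)) * (d * unitBallVolume d * R ^ (-(s * p)) / (p * T ^ d))

/-- The constant in the upper bound of the fractional energies by `F_p^0`. -/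
noncomputable def upperConst (d : ℕ) (T p R s : ℝ) : ℝ :=
  (1 + T * √d / R) ^ ((d : ℝ) + s * p) * (d * unitBallVolume d * R ^ (-(s * p)) / (p * T ^ d))

theorem lowerConst_mul_energyZero_le (hd : 1 ≤ d) (hT : 0 < T) (hp : 1 ≤ p) {R s : ℝ} (hR : 0 < R)
    (hs : 0 < s) (u : PerLp d T p) :
    ENNReal.ofReal (lowerConst d T p R s) * energyZero u ≤ ENNReal.ofReal s * energy s u := by
  have hp0 : 0 < p := by linarith
  have ha : 0 < s * p := by positivity
  set e : ℝ := (d : ℝ) + s * p with he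
  have he0 : 0 < e := by positivity
  set Λ : ℝ := 1 + T * √d / R with hΛ
  have hΛ0 : 0 < Λ := by positivity
  have hω := unitBallVolume_nonneg d
  have key : ∀ x, ENNReal.ofReal (Λ ^ (-e) * (d * unitBallVolume d * (R ^ (-(s * p)) / (s * p)))) *
      (∫⁻ y in cell d T, ENNReal.ofReal (|u x - u y| ^ p)) ≤
      ENNReal.ofReal (T ^ d) * ∫⁻ y, ENNReal.ofReal (|u x - u y| ^ p / ‖x - y‖ ^ e) := by
    intro x
    classical
    -- At `y = x` the kernel `1 / 0 ^ e` has the default value `0`, which would violate `G ≤ g`. The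
    -- value `∞` repairs this at a single point, which is null because `d ≥ 1`.
    set g : EuclideanSpace ℝ (Fin d) → ℝ≥0∞ := fun y =>
      if y = x then ∞ else ENNReal.ofReal (1 / ‖x - y‖ ^ e)
    have hle := lintegral_cell_mul_lintegral_le hT
      (aemeasurable_ofReal_abs_sub_rpow (p := p) u.2.1 (u x))
      (ae_periodic_ofReal_abs_sub_rpow u (u x))
      (G := fun w => ENNReal.ofReal (Λ ^ (-e)) *
        ENNReal.ofReal ((Set.Ioi R).indicator (fun r => 1 / r ^ e) ‖x - w‖))
      (g := g) ((measurable_tail_kernel R e x).const_mul _) ?_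
    · rw [lintegral_const_mul _ (measurable_tail_kernel R e x), lintegral_tail_kernel hd hR ha x,
        ← ENNReal.ofReal_mul (by positivity), mul_comm] at hle
      refine hle.trans_eq ?_
      congr 1
      refine lintegral_congr_ae ?_
      have : Nonempty (Fin d) := ⟨⟨0, hd⟩⟩
      filter_upwards [compl_mem_ae_iff.2 (measure_singleton (μ := volume) x)] with y hy
      have hyx : y ≠ x := hy
      simp only [g, if_neg hyx]
      rw [← ENNReal.ofReal_mul (by positivity), mul_one_div]
    · intro w y hyw
      simp only [g]
      split_ifs with hyx
      · exact le_top
      by_cases hw : ‖x - w‖ ∈ Set.Ioi R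
      · rw [Set.indicator_of_mem hw, ← ENNReal.ofReal_mul (by positivity)]
        refine ENNReal.ofReal_le_ofReal ?_
        have h1 := norm_sub_le_one_add_mul hT hR hyw (le_of_lt hw)
        have hxy : 0 < ‖x - y‖ := norm_pos_iff.2 (sub_ne_zero.2 (Ne.symm hyx))
        rw [Real.rpow_neg hΛ0.le, ← one_div, one_div_mul_one_div,
          ← Real.mul_rpow hΛ0.le (norm_nonneg _)]
        exact one_div_le_one_div_of_le (by positivity)
          (Real.rpow_le_rpow hxy.le h1 he0.le)
      · simp [Set.indicator_of_notMem hw]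
  have hTd : 0 < T ^ d := by positivity
  -- Here `s` cancels against the `1/(s p)` of the tail mass, and `1/T^d` comes from the mean over
  -- cells.
  have hconst : ENNReal.ofReal (lowerConst d T p R s) = ENNReal.ofReal (s / T ^ d) *
      ENNReal.ofReal (Λ ^ (-e) * (d * unitBallVolume d * (R ^ (-(s * p)) / (s * p)))) := by
    rw [← ENNReal.ofReal_mul (by positivity), lowerConst, ← hΛ, ← he]
    congr 1
    clear_value Λ e
    field_simp
  have hsT : ENNReal.ofReal s = ENNReal.ofReal (s / T ^ d) * ENNReal.ofReal (T ^ d) := by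
    rw [← ENNReal.ofReal_mul (by positivity), div_mul_cancel₀ _ hTd.ne']
  rw [hconst, hsT, mul_assoc (ENNReal.ofReal (s / T ^ d)),
    mul_assoc (ENNReal.ofReal (s / T ^ d)) (ENNReal.ofReal (T ^ d))]
  refine mul_le_mul' le_rfl ?_
  rw [energyZero, energy, ← lintegral_const_mul' _ _ ENNReal.ofReal_ne_top,
    ← lintegral_const_mul' _ _ ENNReal.ofReal_ne_top]
  exact lintegral_mono key

/-- The kernel is split at radius `R + T√d`. The far part is compared with cell averages; the near
part is at most `L^p` times the mass of `|x - y|^{-(d - p(1 - s))}`. -/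
theorem energy_le_of_lipschitz (hd : 1 ≤ d) (hT : 0 < T) (hp : 1 ≤ p) {R s L : ℝ} (hR : 0 < R)
    (hs : 0 < s) (hs1 : s < 1) (u : PerLp d T p) (hL : 0 ≤ L)
    (hu : ∀ x y, |u x - u y| ≤ L * ‖x - y‖) :
    ENNReal.ofReal s * energy s u ≤ ENNReal.ofReal (upperConst d T p R s) * energyZero u +
      ENNReal.ofReal (s * (T ^ d * (L ^ p * (d * unitBallVolume d *
        ((R + T * √d) ^ (p * (1 - s)) / (p * (1 - s))))))) := by
  have hp0 : 0 < p := by linarith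
  have ha : 0 < s * p := by positivity
  set e : ℝ := (d : ℝ) + s * p with he
  have he0 : 0 < e := by positivity
  set Λ : ℝ := 1 + T * √d / R with hΛ
  have hΛ0 : 0 < Λ := by positivity
  have hω := unitBallVolume_nonneg d
  set b : ℝ := p * (1 - s) with hb
  have hb0 : 0 < b := mul_pos hp0 (by linarith)
  -- The radius is enlarged by the diameter of a cell so that `|x - y| > R'` forces `|x - w| > R`
  -- for every `w` with `y - w` in the cell.
  set R' : ℝ := R + T * √d with hR'
  have hR'0 : 0 < R' := by positivity
  have hTd : 0 < T ^ d := by positivity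
  set N : ℝ := L ^ p * (d * unitBallVolume d * (R' ^ b / b))
  set K : ℝ := Λ ^ e * (d * unitBallVolume d * (R ^ (-(s * p)) / (s * p))) with hK
  have key : ∀ x, ∫⁻ y, ENNReal.ofReal (|u x - u y| ^ p / ‖x - y‖ ^ e) ≤
      ENNReal.ofReal (K / T ^ d) * (∫⁻ y in cell d T, ENNReal.ofReal (|u x - u y| ^ p)) +
      ENNReal.ofReal N := by
    intro x
    have hfar := lintegral_mul_le_lintegral_cell_mul hT
      (aemeasurable_ofReal_abs_sub_rpow (p := p) u.2.1 (u x))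
      (ae_periodic_ofReal_abs_sub_rpow u (u x))
      (G := fun w => ENNReal.ofReal (Λ ^ e) *
        ENNReal.ofReal ((Set.Ioi R).indicator (fun r => 1 / r ^ e) ‖x - w‖))
      (g := fun y => ENNReal.ofReal ((Set.Ioi R').indicator (fun r => 1 / r ^ e) ‖x - y‖))
      ((measurable_tail_kernel R e x).const_mul _) (by
        intro w y hyw
        by_cases hy : ‖x - y‖ ∈ Set.Ioi R'
        · have hy' : R' < ‖x - y‖ := hy
          have h2 : ‖x - y‖ ≤ ‖x - w‖ + T * √d := by
            rw [show x - y = (x - w) - (y - w) by abel]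
            exact (norm_sub_le _ _).trans (by gcongr; exact norm_le_of_mem_cell hT hyw)
          have hw : ‖x - w‖ ∈ Set.Ioi R := by
            change R < _; linarith
          have hw' : R < ‖x - w‖ := hw
          rw [Set.indicator_of_mem hy, Set.indicator_of_mem hw,
            ← ENNReal.ofReal_mul (by positivity)]
          refine ENNReal.ofReal_le_ofReal ?_
          have h1 := norm_sub_le_one_add_mul' hT hR hyw
            (by linarith [mul_nonneg hT.le (Real.sqrt_nonneg (d : ℝ))] : R ≤ ‖x - y‖)
          have hxy : 0 < ‖x - y‖ := hR'0.trans hy'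
          have hxw : 0 < ‖x - w‖ := hR.trans hw'
          rw [mul_one_div, div_le_div_iff₀ (by positivity) (by positivity), one_mul,
            ← Real.mul_rpow hΛ0.le (norm_nonneg _)]
          exact Real.rpow_le_rpow hxw.le h1 he0.le
        · simp [Set.indicator_of_notMem hy])
    rw [lintegral_const_mul _ (measurable_tail_kernel R e x), lintegral_tail_kernel hd hR ha x,
      ← ENNReal.ofReal_mul (by positivity), mul_comm _ (ENNReal.ofReal (_ * _)), ← hK] at hfar
    have hnear : ∫⁻ y, ENNReal.ofReal (L ^ p) * ENNReal.ofReal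
        ((Set.Ioc 0 R').indicator (fun r => 1 / r ^ ((d : ℝ) - b)) ‖x - y‖) =
        ENNReal.ofReal N := by
      rw [lintegral_const_mul' _ _ ENNReal.ofReal_ne_top,
        lintegral_sub_left_eq_self (fun w => ENNReal.ofReal
        ((Set.Ioc 0 R').indicator (fun r => 1 / r ^ ((d : ℝ) - b)) ‖w‖)) x,
        lintegral_norm_rpow_near hd hR'0 hb0, ← ENNReal.ofReal_mul (by positivity)]
    have hfar' : ∫⁻ y, ENNReal.ofReal (|u x - u y| ^ p) *
        ENNReal.ofReal ((Set.Ioi R').indicator (fun r => 1 / r ^ e) ‖x - y‖) ≤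
        ENNReal.ofReal (K / T ^ d) * (∫⁻ y in cell d T, ENNReal.ofReal (|u x - u y| ^ p)) := by
      have := mul_le_mul' (le_refl (ENNReal.ofReal (T ^ d)⁻¹)) hfar
      rw [← mul_assoc, ← mul_assoc, ← ENNReal.ofReal_mul (by positivity),
        ← ENNReal.ofReal_mul (by positivity), inv_mul_cancel₀ hTd.ne', ENNReal.ofReal_one,
        one_mul, inv_mul_eq_div] at this
      exact this
    refine le_trans ?_ (add_le_add hfar' hnear.le)
    have hmeas : AEMeasurable fun y => ENNReal.ofReal (|u x - u y| ^ p) *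
        ENNReal.ofReal ((Set.Ioi R').indicator (fun r => 1 / r ^ e) ‖x - y‖) :=
      (aemeasurable_ofReal_abs_sub_rpow (p := p) u.2.1 (u x)).mul
        (measurable_tail_kernel R' e x).aemeasurable
    refine le_of_le_of_eq ?_ (lintegral_add_left' hmeas _)
    refine lintegral_mono fun y => ?_
    by_cases hy : R' < ‖x - y‖
    · refine le_trans (le_of_eq ?_) le_self_add
      rw [Set.indicator_of_mem (show ‖x - y‖ ∈ Set.Ioi R' from hy),
        ← ENNReal.ofReal_mul (by positivity), mul_one_div]
    · refine le_trans ?_ le_add_self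
      rcases (norm_nonneg (x - y)).eq_or_lt with h0 | h0
      -- On the diagonal the integrand is `0`, as division by zero has the value `0`.
      · rw [← h0, Real.zero_rpow he0.ne']
        simp
      · rw [Set.indicator_of_mem (show ‖x - y‖ ∈ Set.Ioc 0 R' from ⟨h0, not_lt.1 hy⟩),
          ← ENNReal.ofReal_mul (by positivity)]
        refine ENNReal.ofReal_le_ofReal ?_
        calc |u x - u y| ^ p / ‖x - y‖ ^ e ≤ (L * ‖x - y‖) ^ p / ‖x - y‖ ^ e := by
              gcongr
              exact hu x y
          _ = L ^ p * (1 / ‖x - y‖ ^ ((d : ℝ) - b)) := by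
              rw [Real.mul_rpow hL h0.le, mul_div_assoc, ← Real.rpow_sub h0, one_div,
                ← Real.rpow_neg h0.le]
              congr 2
              rw [he, hb]; ring
  have hconst : ENNReal.ofReal (upperConst d T p R s) =
      ENNReal.ofReal s * ENNReal.ofReal (K / T ^ d) := by
    rw [← ENNReal.ofReal_mul (by positivity), upperConst, hK, ← hΛ, ← he]
    congr 1
    clear_value Λ e
    field_simp
  calc ENNReal.ofReal s * energy s u
      ≤ ENNReal.ofReal s * (∫⁻ x in cell d T, (ENNReal.ofReal (K / T ^ d) *
          (∫⁻ y in cell d T, ENNReal.ofReal (|u x - u y| ^ p)) + ENNReal.ofReal N)) :=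
        mul_le_mul' le_rfl (lintegral_mono key)
    _ = _ := by
        rw [lintegral_add_right _ measurable_const, setLIntegral_const, volume_cell d hT,
          lintegral_const_mul' _ _ ENNReal.ofReal_ne_top, mul_add, ← mul_assoc, ← hconst,
          mul_comm (ENNReal.ofReal N), ← ENNReal.ofReal_mul (by positivity),
          ← ENNReal.ofReal_mul (by positivity)]
        rfl

theorem tendsto_base_rpow_const {R : ℝ} (hR : 0 < R) {s : ℕ → ℝ}
    (hs : Tendsto s atTop (𝓝 0)) :
    Tendsto (fun n => (d : ℝ) * unitBallVolume d * R ^ (-(s n * p)) / (p * T ^ d)) atTop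
      (𝓝 (d * unitBallVolume d / (p * T ^ d))) := by
  have h1 : Tendsto (fun n => R ^ (-(s n * p))) atTop (𝓝 (R ^ (-(0 * p)))) :=
    ((Real.continuous_const_rpow hR.ne').tendsto _).comp ((hs.mul_const p).neg)
  rw [zero_mul, neg_zero, Real.rpow_zero] at h1
  simpa using (h1.const_mul ((d : ℝ) * unitBallVolume d)).div_const (p * T ^ d)

theorem tendsto_lowerConst (hT : 0 < T) {R : ℝ} (hR : 0 < R) {s : ℕ → ℝ}
    (hs : Tendsto s atTop (𝓝 0)) :
    Tendsto (fun n => lowerConst d T p R (s n)) atTop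
      (𝓝 ((1 + T * √d / R) ^ (-(d : ℝ)) * (d * unitBallVolume d / (p * T ^ d)))) := by
  refine Tendsto.mul ?_ (tendsto_base_rpow_const hR hs)
  have hΛ : (1 + T * √d / R) ≠ 0 := by positivity
  have h : Tendsto (fun n => -((d : ℝ) + s n * p)) atTop (𝓝 (-(d + 0 * p))) :=
    ((hs.mul_const p).const_add (d : ℝ)).neg
  rw [zero_mul, add_zero] at h
  exact ((Real.continuous_const_rpow hΛ).tendsto _).comp h

theorem tendsto_upperConst (hT : 0 < T) {R : ℝ} (hR : 0 < R) {s : ℕ → ℝ}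
    (hs : Tendsto s atTop (𝓝 0)) :
    Tendsto (fun n => upperConst d T p R (s n)) atTop
      (𝓝 ((1 + T * √d / R) ^ (d : ℝ) * (d * unitBallVolume d / (p * T ^ d)))) := by
  refine Tendsto.mul ?_ (tendsto_base_rpow_const hR hs)
  have hΛ : (1 + T * √d / R) ≠ 0 := by positivity
  have h : Tendsto (fun n => (d : ℝ) + s n * p) atTop (𝓝 (d + 0 * p)) :=
    (hs.mul_const p).const_add (d : ℝ)
  rw [zero_mul, add_zero] at h
  exact ((Real.continuous_const_rpow hΛ).tendsto _).comp h

theorem tendsto_one_add_div_rpow_mul (c D e : ℝ) :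
    Tendsto (fun R : ℝ => (1 + D / R) ^ e * c) atTop (𝓝 c) := by
  have h1 : Tendsto (fun R : ℝ => 1 + D / R) atTop (𝓝 (1 + 0)) :=
    (tendsto_const_nhds.div_atTop tendsto_id).const_add 1
  rw [add_zero] at h1
  have h2 := (h1.rpow_const (p := e) (Or.inl one_ne_zero)).mul_const c
  rwa [Real.one_rpow, one_mul] at h2

end EnergyBounds

/-! ### Weak convergence, `F^0_p` as the power of a norm, Poincaré's inequality, periodic extension.
-/

section FunctionalAnalysis

variable {d : ℕ} {T p : ℝ}

theorem weakTendsto_iff [Fact (1 ≤ p)] {u : ℕ → PerLp d T p} {v : PerLp d T p} :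
    WeakTendsto u v ↔ ∀ l : PerLp d T p →L[ℝ] ℝ, Tendsto (fun n => l (u n)) atTop (𝓝 (l v)) := by
  have hind : Topology.IsInducing fun (x : WeakSpace ℝ (PerLp d T p))
      (l : PerLp d T p →L[ℝ] ℝ) => l ((toWeakSpace ℝ (PerLp d T p)).symm x) := ⟨rfl⟩
  rw [WeakTendsto, hind.tendsto_nhds_iff, tendsto_pi_nhds]
  rfl

theorem weakTendsto_of_tendsto [Fact (1 ≤ p)] {u : ℕ → PerLp d T p} {v : PerLp d T p}
    (h : Tendsto u atTop (𝓝 v)) : WeakTendsto u v :=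
  weakTendsto_iff.2 fun l => (l.continuous.tendsto v).comp h

theorem norm_eq_restrictCell [Fact (1 ≤ p)] (u : PerLp d T p) :
    ‖u‖ = ‖PerLp.restrictCell d T p u‖ := rfl

theorem enorm_perLp [Fact (1 ≤ p)] (u : PerLp d T p) :
    ‖u‖ₑ = eLpNorm u (ENNReal.ofReal p) (volume.restrict (cell d T)) :=
  Lp.enorm_toLp u.2.2.2

theorem enorm_perLp_rpow [hp : Fact (1 ≤ p)] (u : PerLp d T p) :
    ‖u‖ₑ ^ p = ∫⁻ x in cell d T, ‖u x‖ₑ ^ p := by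
  have hp0 : 0 < p := zero_lt_one.trans_le hp.out
  rw [enorm_perLp, eLpNorm_eq_lintegral_rpow_enorm_toReal (by simpa using hp0)
    ENNReal.ofReal_ne_top, ENNReal.toReal_ofReal hp0.le, ← ENNReal.rpow_mul,
    one_div_mul_cancel hp0.ne', ENNReal.rpow_one]

theorem memLp_difference (u : PerLp d T p) :
    MemLp (fun z : EuclideanSpace ℝ (Fin d) × EuclideanSpace ℝ (Fin d) => u z.1 - u z.2)
      (ENNReal.ofReal p)
      ((volume.restrict (cell d T)).prod (volume.restrict (cell d T))) :=
  (u.2.2.2.comp_fst _).sub (u.2.2.2.comp_snd _)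

/-- The linear map `u ↦ ((x, y) ↦ u x - u y)` from `L^p(𝕋_T^d)` to `L^p(Q_T × Q_T)`. -/
noncomputable def differenceLinear (d : ℕ) (T p : ℝ) :
    PerLp d T p →ₗ[ℝ] Lp ℝ (ENNReal.ofReal p)
      (((volume : Measure (EuclideanSpace ℝ (Fin d))).restrict (cell d T)).prod
        (volume.restrict (cell d T))) where
  toFun u := (memLp_difference u).toLp _
  map_add' u v := by
    rw [← MemLp.toLp_add]
    refine MemLp.toLp_congr _ _ (Eventually.of_forall fun z => ?_)
    exact add_sub_add_comm (u z.1) (v z.1) (u z.2) (v z.2)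
  map_smul' c u := by
    rw [RingHom.id_apply, ← MemLp.toLp_const_smul]
    refine MemLp.toLp_congr _ _ (Eventually.of_forall fun z => ?_)
    exact (mul_sub c (u z.1) (u z.2)).symm

/-- The source of both the continuity and the weak lower semicontinuity of `F^0_p`. -/
theorem enorm_differenceLinear_rpow [hp : Fact (1 ≤ p)] (u : PerLp d T p) :
    ‖differenceLinear d T p u‖ₑ ^ p = energyZero u := by
  have hp0 : 0 < p := zero_lt_one.trans_le hp.out
  have hm : AEMeasurable (fun z : EuclideanSpace ℝ (Fin d) × EuclideanSpace ℝ (Fin d) =>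
      ‖u z.1 - u z.2‖ₑ ^ p) ((volume.restrict (cell d T)).prod (volume.restrict (cell d T))) :=
    (memLp_difference u).1.enorm.pow_const p
  have h1 : ‖differenceLinear d T p u‖ₑ = eLpNorm
      (fun z : EuclideanSpace ℝ (Fin d) × EuclideanSpace ℝ (Fin d) => u z.1 - u z.2)
      (ENNReal.ofReal p) ((volume.restrict (cell d T)).prod (volume.restrict (cell d T))) :=
    Lp.enorm_toLp (memLp_difference u)
  rw [h1, eLpNorm_eq_lintegral_rpow_enorm_toReal (by simpa using hp0)
    ENNReal.ofReal_ne_top, ENNReal.toReal_ofReal hp0.le, ← ENNReal.rpow_mul,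
    one_div_mul_cancel hp0.ne', ENNReal.rpow_one, lintegral_prod _ hm, energyZero]
  refine lintegral_congr fun x => lintegral_congr fun y => ?_
  rw [Real.enorm_eq_ofReal_abs, ENNReal.ofReal_rpow_of_nonneg (abs_nonneg _) hp0.le]

theorem energyZero_ne_top [hp : Fact (1 ≤ p)] (u : PerLp d T p) : energyZero u ≠ ∞ := by
  rw [← enorm_differenceLinear_rpow]
  exact ENNReal.rpow_ne_top_of_nonneg (zero_le_one.trans hp.out) enorm_ne_top

/-- The first projection pushes `μ × μ` forward to `μ(univ) • μ`. -/
theorem eLpNorm_fst_prod {α : Type*} {m : MeasurableSpace α} {μ : Measure α} [IsFiniteMeasure μ]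
    {f : α → ℝ} (hf : AEStronglyMeasurable f μ) {r : ℝ≥0∞} (hr : r ≠ ∞) :
    eLpNorm (fun z : α × α => f z.1) r (μ.prod μ) =
      μ Set.univ ^ (1 / r).toReal * eLpNorm f r μ := by
  have h := eLpNorm_map_measure (p := r) (μ := μ.prod μ) (f := Prod.fst) (g := f)
    (by rw [Measure.map_fst_prod]; exact hf.smul_measure _) measurable_fst.aemeasurable
  rw [Measure.map_fst_prod, eLpNorm_smul_measure_of_ne_top hr, smul_eq_mul] at h
  exact h.symm

theorem eLpNorm_snd_prod {α : Type*} {m : MeasurableSpace α} {μ : Measure α} [IsFiniteMeasure μ]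
    {f : α → ℝ} (hf : AEStronglyMeasurable f μ) {r : ℝ≥0∞} (hr : r ≠ ∞) :
    eLpNorm (fun z : α × α => f z.2) r (μ.prod μ) =
      μ Set.univ ^ (1 / r).toReal * eLpNorm f r μ := by
  have h := eLpNorm_map_measure (p := r) (μ := μ.prod μ) (f := Prod.snd) (g := f)
    (by rw [Measure.map_snd_prod]; exact hf.smul_measure _) measurable_snd.aemeasurable
  rw [Measure.map_snd_prod, eLpNorm_smul_measure_of_ne_top hr, smul_eq_mul] at h
  exact h.symm

theorem eLpNorm_difference_le {α : Type*} {m : MeasurableSpace α} {μ : Measure α}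
    [IsFiniteMeasure μ] {f : α → ℝ} (hf : AEStronglyMeasurable f μ) {r : ℝ≥0∞} (hr1 : 1 ≤ r)
    (hr : r ≠ ∞) :
    eLpNorm (fun z : α × α => f z.1 - f z.2) r (μ.prod μ) ≤
      2 * μ Set.univ ^ (1 / r).toReal * eLpNorm f r μ := by
  refine (eLpNorm_sub_le hf.comp_fst hf.comp_snd hr1).trans_eq ?_
  rw [eLpNorm_fst_prod hf hr, eLpNorm_snd_prod hf hr]
  ring

theorem enorm_differenceLinear_le [hp : Fact (1 ≤ p)] (u : PerLp d T p) :
    ‖differenceLinear d T p u‖ₑ ≤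
      2 * volume (cell d T) ^ (1 / ENNReal.ofReal p).toReal * ‖u‖ₑ := by
  have h := eLpNorm_difference_le (r := ENNReal.ofReal p) u.2.2.2.1
    (by rw [← ENNReal.ofReal_one]; exact ENNReal.ofReal_le_ofReal hp.out) ENNReal.ofReal_ne_top
  rw [Measure.restrict_apply_univ, ← enorm_perLp] at h
  exact (Lp.enorm_toLp (memLp_difference u)).trans_le h

/-- The continuous linear map `u ↦ ((x, y) ↦ u x - u y)` from `L^p(𝕋_T^d)` to `L^p(Q_T × Q_T)`. -/
noncomputable def differenceCLM (d : ℕ) (T p : ℝ) [Fact (1 ≤ p)] :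
    PerLp d T p →L[ℝ] Lp ℝ (ENNReal.ofReal p)
      (((volume : Measure (EuclideanSpace ℝ (Fin d))).restrict (cell d T)).prod
        (volume.restrict (cell d T))) :=
  (differenceLinear d T p).mkContinuous (2 * volume (cell d T) ^ (1 / ENNReal.ofReal p).toReal).toReal fun u => by
    have h := enorm_differenceLinear_le u
    have hfin : 2 * volume (cell d T) ^ (1 / ENNReal.ofReal p).toReal * ‖u‖ₑ ≠ ∞ :=
      ENNReal.mul_ne_top (ENNReal.mul_ne_top ENNReal.ofNat_ne_top
        (ENNReal.rpow_ne_top_of_nonneg (by positivity) (cell_volume_lt_top d T).ne)) enorm_ne_top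
    have := ENNReal.toReal_mono hfin h
    rwa [ENNReal.toReal_mul, toReal_enorm, toReal_enorm] at this

theorem ofReal_norm_differenceCLM_rpow [hp : Fact (1 ≤ p)] (u : PerLp d T p) :
    ENNReal.ofReal (‖differenceCLM d T p u‖ ^ p) = energyZero u := by
  rw [← enorm_differenceLinear_rpow, ← ENNReal.ofReal_rpow_of_nonneg (norm_nonneg _)
    (zero_le_one.trans hp.out), ofReal_norm]
  rfl

theorem continuous_energyZero [hp : Fact (1 ≤ p)] :
    Continuous (energyZero : PerLp d T p → ℝ≥0∞) := by
  have : (energyZero : PerLp d T p → ℝ≥0∞) =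
      fun u => ENNReal.ofReal (‖differenceCLM d T p u‖ ^ p) :=
    funext fun u => (ofReal_norm_differenceCLM_rpow u).symm
  rw [this]
  exact ENNReal.continuous_ofReal.comp
    ((differenceCLM d T p).continuous.norm.rpow_const fun _ => Or.inr (zero_le_one.trans hp.out))

/-- Weak lower semicontinuity of `F_p^0`. -/
theorem energyZero_le_liminf [hp : Fact (1 ≤ p)] {w : ℕ → PerLp d T p} {u : PerLp d T p}
    (h : WeakTendsto w u) : energyZero u ≤ liminf (fun n => energyZero (w n)) atTop := by
  have hp0 : 0 < p := zero_lt_one.trans_le hp.out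
  by_cases h0 : ‖differenceCLM d T p u‖ = 0
  · rw [← ofReal_norm_differenceCLM_rpow, h0, Real.zero_rpow hp0.ne', ENNReal.ofReal_zero]
    exact zero_le
  -- A norming functional from Hahn–Banach: its values along `w n` converge to the norm of the
  -- limit, and each is at most the norm of the difference function of `w n`.
  obtain ⟨g, hg1, hg⟩ := exists_dual_vector ℝ (differenceCLM d T p u) h0
  have hlim := weakTendsto_iff.1 h (g.comp (differenceCLM d T p))
  have hlim' : Tendsto (fun n => ENNReal.ofReal (|g (differenceCLM d T p (w n))| ^ p)) atTop
      (𝓝 (energyZero u)) := by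
    rw [← ofReal_norm_differenceCLM_rpow]
    refine (ENNReal.continuous_ofReal.tendsto _).comp ?_
    have h1 := (hlim.abs).rpow_const (p := p) (Or.inr hp0.le)
    simp only [ContinuousLinearMap.comp_apply, hg] at h1
    simpa using h1
  rw [← hlim'.liminf_eq]
  refine liminf_le_liminf (Eventually.of_forall fun n => ?_)
  rw [← ofReal_norm_differenceCLM_rpow]
  refine ENNReal.ofReal_le_ofReal (Real.rpow_le_rpow (abs_nonneg _) ?_ hp0.le)
  have := g.le_opNorm (differenceCLM d T p (w n))
  rwa [hg1, one_mul] at this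

theorem integrable_cell [hp : Fact (1 ≤ p)] (u : PerLp d T p) :
    Integrable u (volume.restrict (cell d T)) :=
  u.2.2.2.integrable (by rw [← ENNReal.ofReal_one]; exact ENNReal.ofReal_le_ofReal hp.out)

theorem enorm_setIntegral_cell_le [hp : Fact (1 ≤ p)] {f : EuclideanSpace ℝ (Fin d) → ℝ}
    (hf : AEStronglyMeasurable f (volume.restrict (cell d T))) :
    ‖∫ x in cell d T, f x‖ₑ ≤
      eLpNorm f (ENNReal.ofReal p) (volume.restrict (cell d T)) *
        volume (cell d T) ^ (1 - 1 / p) := by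
  have hp0 : 0 < p := zero_lt_one.trans_le hp.out
  have h1 := eLpNorm_le_eLpNorm_mul_rpow_measure_univ (p := 1) (q := ENNReal.ofReal p)
    (by rw [← ENNReal.ofReal_one]; exact ENNReal.ofReal_le_ofReal hp.out) hf
  rw [Measure.restrict_apply_univ, ENNReal.toReal_ofReal hp0.le, ENNReal.toReal_one,
    div_one] at h1
  refine le_trans ?_ h1
  rw [eLpNorm_one_eq_lintegral_enorm]
  exact enorm_integral_le_lintegral_enorm _

/-- The average over the cell as a continuous linear functional. -/
theorem exists_cellAverage_clm [hp : Fact (1 ≤ p)] :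
    ∃ A : PerLp d T p →L[ℝ] ℝ, ∀ u, A u = cellAverage u := by
  have hp0 : 0 < p := zero_lt_one.trans_le hp.out
  have hexp : 0 ≤ 1 - 1 / p := by
    rw [sub_nonneg, div_le_one hp0]; exact hp.out
  let A : PerLp d T p →ₗ[ℝ] ℝ :=
    { toFun := cellAverage
      map_add' := fun u v => by
        have : ∫ x in cell d T, (u + v) x = (∫ x in cell d T, u x) + ∫ x in cell d T, v x :=
          integral_add (integrable_cell u) (integrable_cell v)
        rw [cellAverage, this, mul_add]
        rfl
      map_smul' := fun c u => by
        have : ∫ x in cell d T, (c • u) x = c * ∫ x in cell d T, u x :=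
          integral_const_mul c _
        rw [cellAverage, this, RingHom.id_apply, smul_eq_mul, cellAverage]
        ring }
  refine ⟨A.mkContinuous (|1 / T ^ d| * (volume (cell d T) ^ (1 - 1 / p)).toReal) fun u => ?_,
    fun u => rfl⟩
  have h := enorm_setIntegral_cell_le (p := p) (integrable_cell u).1
  rw [← enorm_perLp] at h
  have h2 := ENNReal.toReal_mono (ENNReal.mul_ne_top enorm_ne_top
    (ENNReal.rpow_ne_top_of_nonneg hexp (cell_volume_lt_top d T).ne)) h
  rw [ENNReal.toReal_mul, toReal_enorm, toReal_enorm, mul_comm] at h2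
  change ‖(1 / T ^ d) * ∫ x in cell d T, u x‖ ≤ _
  rw [norm_mul, mul_assoc]
  exact mul_le_mul_of_nonneg_left h2 (abs_nonneg _)

theorem cellAverage_center [Fact (1 ≤ p)] (hT : 0 < T) (u : PerLp d T p) :
    cellAverage (center u) = 0 := by
  have hvol : (volume.restrict (cell d T)).real Set.univ = T ^ d := by
    rw [Measure.real, Measure.restrict_apply_univ, volume_cell d hT,
      ENNReal.toReal_ofReal (by positivity)]
  have h : ∫ x in cell d T, center u x = (∫ x in cell d T, u x) - T ^ d * cellAverage u := by
    change ∫ x in cell d T, (u x - cellAverage u) = _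
    rw [integral_sub (integrable_cell u) (integrable_const _), integral_const, hvol, smul_eq_mul]
  rw [cellAverage, h, cellAverage]
  field_simp
  ring

/-- Poincaré's inequality: the distance to the average is controlled by `F_p^0`. -/
theorem enorm_center_rpow_le [hp : Fact (1 ≤ p)] (hT : 0 < T) (u : PerLp d T p) :
    ‖center u‖ₑ ^ p ≤
      (ENNReal.ofReal (1 / T ^ d) * volume (cell d T) ^ (1 - 1 / p)) ^ p * energyZero u := by
  have hp0 : 0 < p := zero_lt_one.trans_le hp.out
  have hexp : 0 ≤ 1 - 1 / p := by
    rw [sub_nonneg, div_le_one hp0]; exact hp.out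
  have hvol : (volume.restrict (cell d T)).real Set.univ = T ^ d := by
    rw [Measure.real, Measure.restrict_apply_univ, volume_cell d hT,
      ENNReal.toReal_ofReal (by positivity)]
  have hfin : (ENNReal.ofReal (1 / T ^ d) * volume (cell d T) ^ (1 - 1 / p)) ^ p ≠ ∞ :=
    ENNReal.rpow_ne_top_of_nonneg hp0.le (ENNReal.mul_ne_top ENNReal.ofReal_ne_top
      (ENNReal.rpow_ne_top_of_nonneg hexp (cell_volume_lt_top d T).ne))
  rw [enorm_perLp_rpow, energyZero, ← lintegral_const_mul' _ _ hfin]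
  refine lintegral_mono fun x => ?_
  -- The deviation from the average is the mean over `y` of `u x - u y`; Hölder in `y`, then
  -- integration in `x`, gives the estimate.
  have hx : center u x = (1 / T ^ d) * ∫ y in cell d T, (u x - u y) := by
    rw [integral_sub (integrable_const _) (integrable_cell u), integral_const, hvol, smul_eq_mul,
      mul_sub, ← mul_assoc, one_div_mul_cancel (by positivity), one_mul]
    rfl
  have hmeas : AEStronglyMeasurable (fun y => u x - u y) (volume.restrict (cell d T)) :=
    aestronglyMeasurable_const.sub (integrable_cell u).1
  have hle := enorm_setIntegral_cell_le (p := p) hmeas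
  calc ‖center u x‖ₑ ^ p
      = (ENNReal.ofReal (1 / T ^ d) * ‖∫ y in cell d T, (u x - u y)‖ₑ) ^ p := by
        rw [hx, enorm_mul, Real.enorm_of_nonneg (by positivity)]
    _ ≤ (ENNReal.ofReal (1 / T ^ d) *
          (eLpNorm (fun y => u x - u y) (ENNReal.ofReal p) (volume.restrict (cell d T)) *
            volume (cell d T) ^ (1 - 1 / p))) ^ p := by gcongr
    _ = (ENNReal.ofReal (1 / T ^ d) * volume (cell d T) ^ (1 - 1 / p)) ^ p *
          eLpNorm (fun y => u x - u y) (ENNReal.ofReal p) (volume.restrict (cell d T)) ^ p := by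
        rw [← ENNReal.mul_rpow_of_nonneg _ _ hp0.le]
        congr 1; ring
    _ = _ := by
        congr 1
        rw [eLpNorm_eq_lintegral_rpow_enorm_toReal (by simpa using hp0)
          ENNReal.ofReal_ne_top, ENNReal.toReal_ofReal hp0.le, ← ENNReal.rpow_mul,
          one_div_mul_cancel hp0.ne', ENNReal.rpow_one]
        refine lintegral_congr fun y => ?_
        rw [Real.enorm_eq_ofReal_abs, ENNReal.ofReal_rpow_of_nonneg (abs_nonneg _) hp0.le]

/-- Reduction of a point modulo the lattice `T ℤ^d`. -/
noncomputable def reduceCell (d : ℕ) (T : ℝ) (x : EuclideanSpace ℝ (Fin d)) :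
    EuclideanSpace ℝ (Fin d) :=
  WithLp.toLp 2 fun i => T * Int.fract (x i / T)

theorem measurable_reduceCell (d : ℕ) (T : ℝ) : Measurable (reduceCell d T) := by
  refine (MeasurableEquiv.toLp 2 (Fin d → ℝ)).measurable.comp (measurable_pi_lambda _ fun i => ?_)
  exact (measurable_fract.comp (by fun_prop)).const_mul T

theorem reduceCell_add_single (hT : 0 < T) (x : EuclideanSpace ℝ (Fin d)) (i : Fin d) :
    reduceCell d T (x + T • EuclideanSpace.single i (1 : ℝ)) = reduceCell d T x := by
  ext j
  simp only [reduceCell, PiLp.add_apply, PiLp.smul_apply, smul_eq_mul]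
  by_cases h : j = i
  · subst h
    rw [PiLp.single_apply, if_pos rfl, mul_one, add_div, div_self hT.ne',
      Int.fract_add_one]
  · rw [PiLp.single_apply, if_neg h, mul_zero, add_zero]

theorem reduceCell_eq_self (hT : 0 < T) {x : EuclideanSpace ℝ (Fin d)}
    (hx : ∀ i, x i ∈ Set.Ico 0 T) : reduceCell d T x = x := by
  ext j
  have h : Int.fract (x j / T) = x j / T :=
    Int.fract_eq_self.2 ⟨div_nonneg (hx j).1 hT.le, (div_lt_one hT).2 (hx j).2⟩
  simp only [reduceCell, h]
  field_simp

theorem ae_cell_mem_Ico (hT : 0 < T) :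
    ∀ᵐ x ∂(volume : Measure (EuclideanSpace ℝ (Fin d))).restrict (cell d T),
      ∀ i, x i ∈ Set.Ico 0 T := by
  filter_upwards [ae_restrict_mem (measurableSet_cell d T), ae_restrict_of_ae
    (fundamentalDomain_ae_eq_cell (d := d) hT)] with x hx hx'
  have : x ∈ ZSpan.fundamentalDomain (latticeBasis d hT) := by
    have h : (x ∈ ZSpan.fundamentalDomain (latticeBasis d hT)) = (x ∈ cell d T) := hx'
    rw [h]; exact hx
  exact (mem_fundamentalDomain_latticeBasis hT).1 this

/-- Every element of `L^p(Q_T)` is the restriction of a periodic function. -/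
theorem exists_restrictCell_eq [Fact (1 ≤ p)] (hT : 0 < T)
    (f : Lp ℝ (ENNReal.ofReal p)
      ((volume : Measure (EuclideanSpace ℝ (Fin d))).restrict (cell d T))) :
    ∃ u : PerLp d T p, PerLp.restrictCell d T p u = f := by
  have hae : (fun x => f (reduceCell d T x)) =ᵐ[volume.restrict (cell d T)] f := by
    filter_upwards [ae_cell_mem_Ico hT] with x hx
    rw [reduceCell_eq_self hT hx]
  have hm : AEStronglyMeasurable (fun x => f (reduceCell d T x)) volume :=
    ((Lp.stronglyMeasurable f).comp_measurable (measurable_reduceCell d T)).aestronglyMeasurable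
  have hL : MemLp (fun x => f (reduceCell d T x)) (ENNReal.ofReal p)
      (volume.restrict (cell d T)) := (memLp_congr_ae hae).2 (Lp.memLp f)
  refine ⟨⟨fun x => f (reduceCell d T x), hm, fun i => Eventually.of_forall fun x => ?_, hL⟩, ?_⟩
  · simp only [reduceCell_add_single hT]
  · exact Lp.ext (hL.coeFn_toLp.trans hae)

/-- Continuous linear functionals on `L^p(𝕋_T^d)` are functionals of the restriction to `Q_T`. -/
theorem exists_functional_restrictCell [Fact (1 ≤ p)] (hT : 0 < T) (l : PerLp d T p →L[ℝ] ℝ) :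
    ∃ l' : Lp ℝ (ENNReal.ofReal p)
      ((volume : Measure (EuclideanSpace ℝ (Fin d))).restrict (cell d T)) →L[ℝ] ℝ,
      ∀ u, l u = l' (PerLp.restrictCell d T p u) := by
  -- The space is only seminormed, so `l` must be seen to ignore changes on null sets. This also
  -- makes `f ↦ l (E f)` linear, although the chosen periodic extension `E` need not be.
  have hl : ∀ u v, PerLp.restrictCell d T p u = PerLp.restrictCell d T p v → l u = l v := by
    intro u v h
    have h0 : ‖u - v‖ = 0 := by rw [norm_eq_restrictCell, map_sub, h, sub_self, norm_zero]
    have := l.le_opNorm (u - v)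
    rw [h0, mul_zero, norm_le_zero_iff, map_sub, sub_eq_zero] at this
    exact this
  choose E hE using fun f => exists_restrictCell_eq (d := d) (p := p) hT f
  let l' : Lp ℝ (ENNReal.ofReal p)
      ((volume : Measure (EuclideanSpace ℝ (Fin d))).restrict (cell d T)) →ₗ[ℝ] ℝ :=
    { toFun := fun f => l (E f)
      map_add' := fun f g => by
        rw [← map_add]
        exact hl _ _ (by rw [map_add, hE, hE, hE])
      map_smul' := fun c f => by
        rw [RingHom.id_apply, ← map_smul]
        exact hl _ _ (by rw [map_smul, hE, hE]) }
  refine ⟨l'.mkContinuous ‖l‖ fun f => ?_, fun u => hl _ _ (hE _).symm⟩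
  have := l.le_opNorm (E f)
  rwa [norm_eq_restrictCell, hE] at this

theorem exists_weakTendsto_subseq [Fact (1 ≤ p)] (hT : 0 < T) (hp : 1 < p)
    {u : ℕ → PerLp d T p} {C : ℝ} (hu : ∀ n, ‖u n‖ ≤ C) :
    ∃ φ : ℕ → ℕ, StrictMono φ ∧ ∃ v, WeakTendsto (fun k => u (φ k)) v := by
  obtain ⟨φ, hφ, v, hv⟩ := exists_weakly_convergent_subseq hp
    (f := fun n => PerLp.restrictCell d T p (u n)) (C := C) hu
  obtain ⟨v', rfl⟩ := exists_restrictCell_eq hT v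
  refine ⟨φ, hφ, v', weakTendsto_iff.2 fun l => ?_⟩
  obtain ⟨l', hl'⟩ := exists_functional_restrictCell hT l
  simpa only [hl'] using hv l'

end FunctionalAnalysis

/-! ### Density of Lipschitz periodic functions. -/

section Density

variable {d : ℕ} {T p : ℝ}

theorem single_mem_lattice (hT : 0 < T) (i : Fin d) :
    T • EuclideanSpace.single i (1 : ℝ) ∈ lattice d hT := by
  rw [← latticeBasis_apply hT i]
  exact Submodule.subset_span (Set.mem_range_self i)

theorem isClosed_add_lattice (hT : 0 < T) {K : Set (EuclideanSpace ℝ (Fin d))} (hK : IsCompact K) :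
    IsClosed (K + (lattice d hT : Set (EuclideanSpace ℝ (Fin d)))) := by
  have : DiscreteTopology (Submodule.span ℤ (Set.range (latticeBasis d hT))).toAddSubgroup :=
    inferInstance
  exact IsClosed.add_left_of_isCompact AddSubgroup.isClosed_of_discrete hK

/-- Reduction modulo the lattice fixes the points of the fundamental domain, so periodizing `K` adds
nothing inside that domain. -/
theorem mem_of_mem_add_lattice (hT : 0 < T) {K : Set (EuclideanSpace ℝ (Fin d))}
    (hK : K ⊆ ZSpan.fundamentalDomain (latticeBasis d hT)) {x : EuclideanSpace ℝ (Fin d)}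
    (hx : x ∈ ZSpan.fundamentalDomain (latticeBasis d hT))
    (hxK : x ∈ K + (lattice d hT : Set (EuclideanSpace ℝ (Fin d)))) : x ∈ K := by
  obtain ⟨k, hk, g, hg, rfl⟩ := Set.mem_add.1 hxK
  have h1 := ZSpan.fract_eq_self.2 hx
  rw [ZSpan.fract_add_ZSpan _ _ hg, ZSpan.fract_eq_self.2 (hK hk)] at h1
  rwa [← h1]

theorem infEDist_add_lattice (hT : 0 < T) (K : Set (EuclideanSpace ℝ (Fin d)))
    {g : EuclideanSpace ℝ (Fin d)} (hg : g ∈ lattice d hT) (x : EuclideanSpace ℝ (Fin d)) :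
    Metric.infEDist (x + g) (K + (lattice d hT : Set (EuclideanSpace ℝ (Fin d)))) =
      Metric.infEDist x (K + (lattice d hT : Set (EuclideanSpace ℝ (Fin d)))) := by
  have himg : (fun y => y + g) '' (K + (lattice d hT : Set (EuclideanSpace ℝ (Fin d)))) =
      K + (lattice d hT : Set (EuclideanSpace ℝ (Fin d))) := by
    ext y
    simp only [Set.mem_image, Set.mem_add]
    constructor
    · rintro ⟨_, ⟨k, hk, h, hh, rfl⟩, rfl⟩
      exact ⟨k, hk, h + g, add_mem hh hg, (add_assoc _ _ _).symm⟩
    · rintro ⟨k, hk, h, hh, rfl⟩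
      exact ⟨k + (h - g), ⟨k, hk, h - g, sub_mem hh hg, rfl⟩, by abel⟩
  have := Metric.infEDist_image (isometry_add_right g) (x := x)
    (t := K + (lattice d hT : Set (EuclideanSpace ℝ (Fin d))))
  rwa [himg] at this

/-- Lipschitz functions on `ℝ^d` that are `T`-periodic in each coordinate direction. -/
def IsPeriodicLipschitz (T : ℝ) (g : EuclideanSpace ℝ (Fin d) → ℝ) : Prop :=
  (∃ L, 0 ≤ L ∧ ∀ x y, |g x - g y| ≤ L * ‖x - y‖) ∧
    ∀ (i : Fin d) x, g (x + T • EuclideanSpace.single i (1 : ℝ)) = g x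

theorem IsPeriodicLipschitz.add {f g : EuclideanSpace ℝ (Fin d) → ℝ}
    (hf : IsPeriodicLipschitz T f) (hg : IsPeriodicLipschitz T g) :
    IsPeriodicLipschitz T (f + g) := by
  obtain ⟨⟨L, hL, hf⟩, hf'⟩ := hf
  obtain ⟨⟨M, hM, hg⟩, hg'⟩ := hg
  refine ⟨⟨L + M, by positivity, fun x y => ?_⟩, fun i x => ?_⟩
  · simp only [Pi.add_apply]
    rw [add_sub_add_comm, add_mul]
    exact (abs_add_le _ _).trans (add_le_add (hf x y) (hg x y))
  · simp only [Pi.add_apply, hf', hg']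

theorem IsPeriodicLipschitz.continuous {f : EuclideanSpace ℝ (Fin d) → ℝ}
    (hf : IsPeriodicLipschitz T f) : Continuous f := by
  obtain ⟨⟨L, hL, hf⟩, -⟩ := hf
  refine (LipschitzWith.of_dist_le_mul (K := ⟨L, hL⟩) fun x y => ?_).continuous
  rw [Real.dist_eq, dist_eq_norm]
  exact hf x y

theorem IsPeriodicLipschitz.memLp (hT : 0 < T) {f : EuclideanSpace ℝ (Fin d) → ℝ}
    (hf : IsPeriodicLipschitz T f) (r : ℝ≥0∞) : MemLp f r (volume.restrict (cell d T)) := by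
  have hc := hf.continuous
  obtain ⟨⟨L, hL, hf⟩, -⟩ := hf
  refine MemLp.of_bound hc.aestronglyMeasurable (|f 0| + L * (T * √d)) ?_
  filter_upwards [ae_restrict_mem (measurableSet_cell d T)] with x hx
  have h1 := hf x 0
  rw [sub_zero] at h1
  have h2 : L * ‖x‖ ≤ L * (T * √d) := mul_le_mul_of_nonneg_left (norm_le_of_mem_cell hT hx) hL
  rw [Real.norm_eq_abs]
  have h3 := abs_sub_abs_le_abs_sub (f x) (f 0)
  linarith

/-- Approximate `A` inside the fundamental domain by a compact `K`, periodize it, and take the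
thickened indicator of the closed set `K + T ℤ^d`. It is Lipschitz with constant `1/δ`, and periodic
since it depends only on the distance to an invariant set. -/
theorem exists_isPeriodicLipschitz_indicator (hT : 0 < T) {r : ℝ≥0∞} (hr : r ≠ ∞) (c : ℝ)
    {A : Set (EuclideanSpace ℝ (Fin d))} (hA : MeasurableSet A) {ε : ℝ≥0∞} (hε : ε ≠ 0) :
    ∃ g, eLpNorm (g - A.indicator fun _ => c) r (volume.restrict (cell d T)) ≤ ε ∧
      IsPeriodicLipschitz T g := by
  set μ := (volume : Measure (EuclideanSpace ℝ (Fin d))).restrict (cell d T)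
  set F := ZSpan.fundamentalDomain (latticeBasis d hT)
  obtain ⟨η, hη0, hη⟩ := exists_eLpNorm_indicator_le (μ := μ) hr c hε
  have hη2 : (η : ℝ≥0∞) / 2 ≠ 0 := by simpa using hη0.ne'
  have hFm : MeasurableSet F := ZSpan.fundamentalDomain_measurableSet _
  obtain ⟨K, hKA, hK, -, hμK⟩ := (hA.inter hFm).exists_isCompact_isClosed_sdiff_lt (μ := μ)
    (measure_ne_top _ _) hη2
  set K' := K + (lattice d hT : Set (EuclideanSpace ℝ (Fin d)))
  have hK' : IsClosed K' := isClosed_add_lattice hT hK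
  have hthick := tendsto_measure_thickening_of_isClosed (μ := μ)
    ⟨1, zero_lt_one, measure_ne_top _ _⟩ hK'
  have hlt : μ K' < μ K' + η / 2 := ENNReal.lt_add_right (measure_ne_top _ _) hη2
  obtain ⟨δ, hδμ, hδ⟩ := ((hthick.eventually (gt_mem_nhds hlt)).and self_mem_nhdsWithin).exists
  have hδ0 : 0 < δ := hδ
  set f : EuclideanSpace ℝ (Fin d) → ℝ := fun x => (thickenedIndicator hδ0 K' x : ℝ)
  have hf1 : ∀ x, f x ≤ 1 := fun x => by exact_mod_cast thickenedIndicator_le_one hδ0 K' x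
  have hf0 : ∀ x, 0 ≤ f x := fun x => NNReal.coe_nonneg _
  refine ⟨fun x => c * f x, ?_, ⟨|c| * (δ.toNNReal⁻¹ : NNReal), by positivity, fun x y => ?_⟩,
    fun i x => ?_⟩
  -- Outside `S`, up to a null set, the approximation equals `c 1_A` on the cell; on `S` the error
  -- is at most `|c|`. Each of the two pieces of `S` has measure at most `η / 2`.
  · set S := ((A ∩ F) \ K) ∪ (Metric.thickening δ K' \ K')
    have hS : μ S ≤ η := by
      have h1 : μ (Metric.thickening δ K' \ K') ≤ η / 2 := by
        rw [measure_sdiff (Metric.self_subset_thickening hδ0 K')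
          hK'.measurableSet.nullMeasurableSet (measure_ne_top _ _)]
        exact tsub_le_iff_left.2 hδμ.le
      calc μ S ≤ _ := measure_union_le _ _
        _ ≤ η / 2 + η / 2 := add_le_add hμK.le h1
        _ = η := ENNReal.add_halves _
    refine le_trans (eLpNorm_mono_ae ?_) (hη S hS)
    filter_upwards [ae_cell_mem_Ico hT] with x hx
    have hxF : x ∈ F := (mem_fundamentalDomain_latticeBasis hT).2 hx
    have hKK' : K ⊆ K' := fun k hk => Set.mem_add.2 ⟨k, hk, 0, zero_mem _, add_zero k⟩
    simp only [Pi.sub_apply]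
    by_cases hxS : x ∈ S
    · rw [Set.indicator_of_mem hxS, Real.norm_eq_abs, Real.norm_eq_abs]
      by_cases hxA : x ∈ A
      · rw [Set.indicator_of_mem hxA, show c * f x - c = c * (f x - 1) by ring, abs_mul]
        refine mul_le_of_le_one_right (abs_nonneg _) ?_
        rw [abs_le]
        constructor <;> linarith [hf0 x, hf1 x]
      · rw [Set.indicator_of_notMem hxA, sub_zero, abs_mul]
        refine mul_le_of_le_one_right (abs_nonneg _) ?_
        rw [abs_of_nonneg (hf0 x)]
        exact hf1 x
    · rw [Set.indicator_of_notMem hxS, norm_zero, norm_le_zero_iff, sub_eq_zero]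
      by_cases hxK : x ∈ K
      · have hfx : f x = 1 := by
          simp only [f, thickenedIndicator_one hδ0 K' (hKK' hxK), NNReal.coe_one]
        rw [hfx, mul_one, Set.indicator_of_mem (hKA hxK).1]
      · have hxA : x ∉ A := fun h => hxS (Or.inl ⟨⟨h, hxF⟩, hxK⟩)
        have hxK' : x ∉ K' := fun h =>
          hxK (mem_of_mem_add_lattice hT (fun k hk => (hKA hk).2) hxF h)
        have hxδ : x ∉ Metric.thickening δ K' := fun h => hxS (Or.inr ⟨h, hxK'⟩)
        have hfx : f x = 0 := by
          simp only [f, thickenedIndicator_zero hδ0 K' hxδ, NNReal.coe_zero]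
        rw [hfx, mul_zero, Set.indicator_of_notMem hxA]
  · rw [← mul_sub, abs_mul, mul_assoc]
    refine mul_le_mul_of_nonneg_left ?_ (abs_nonneg c)
    have := (lipschitzWith_thickenedIndicator hδ0 K').dist_le_mul x y
    rwa [NNReal.dist_eq, dist_eq_norm] at this
  · simp only [f, thickenedIndicator_apply, thickenedIndicatorAux]
    rw [infEDist_add_lattice hT K (single_mem_lattice hT i)]

/-- Lipschitz periodic functions are dense in `L^p(𝕋_T^d)`. -/
theorem exists_lipschitz_norm_sub_le [hp : Fact (1 ≤ p)] (hT : 0 < T) (u : PerLp d T p) {ε : ℝ}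
    (hε : 0 < ε) :
    ∃ v : PerLp d T p, ‖u - v‖ ≤ ε ∧ ∃ L, 0 ≤ L ∧ ∀ x y, |v x - v y| ≤ L * ‖x - y‖ := by
  obtain ⟨g, hg, hgP⟩ := u.2.2.2.induction_dense ENNReal.ofReal_ne_top (IsPeriodicLipschitz T)
    (fun c A hA _ ε hε => exists_isPeriodicLipschitz_indicator hT ENNReal.ofReal_ne_top c hA hε)
    (fun f g hf hg => hf.add hg) (fun f hf => hf.continuous.aestronglyMeasurable)
    (ENNReal.ofReal_pos.2 hε).ne'
  refine ⟨⟨g, hgP.continuous.aestronglyMeasurable, fun i => Eventually.of_forall (hgP.2 i),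
    hgP.memLp hT _⟩, ?_, hgP.1⟩
  rw [← ENNReal.ofReal_le_ofReal_iff hε.le, ofReal_norm, enorm_perLp]
  exact hg

end Density

/-! ### The three parts of the theorem. -/

section GammaConvergence

variable {d : ℕ} {T p : ℝ}

theorem unitBallVolume_pos (d : ℕ) : 0 < unitBallVolume d :=
  ENNReal.toReal_pos (Metric.measure_ball_pos volume _ zero_lt_one).ne' measure_ball_lt_top.ne

/-- With `N j` a threshold from which the `j`-th bound holds, `k n` is the largest `j ≤ n` with `N j
≤ n`. For `n ≥ N 0` the index `0` qualifies, so the search succeeds. -/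
theorem exists_diagonal {a : ℕ → ℕ → ℝ≥0∞} {b : ℕ → ℝ≥0∞}
    (h : ∀ j, ∀ᶠ n in atTop, a n j ≤ b j) :
    ∃ k : ℕ → ℕ, Tendsto k atTop atTop ∧ ∀ᶠ n in atTop, a n (k n) ≤ b (k n) := by
  choose N hN using fun j => eventually_atTop.1 (h j)
  refine ⟨fun n => Nat.findGreatest (fun j => N j ≤ n) n, tendsto_atTop.2 fun j => ?_, ?_⟩
  · filter_upwards [eventually_ge_atTop (max j (N j))] with n hn
    exact Nat.le_findGreatest ((le_max_left _ _).trans hn) ((le_max_right _ _).trans hn)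
  · filter_upwards [eventually_ge_atTop (N 0)] with n hn
    exact hN _ _ (Nat.findGreatest_spec (P := fun j => N j ≤ n) n.zero_le hn)

/-- First `n → ∞` at fixed `R`, then `R → ∞`; the second limit uses that `F^0_p(u)` is finite. -/
theorem mul_energyZero_le_liminf (hd : 1 ≤ d) (hT : 0 < T) [hp : Fact (1 ≤ p)] {s : ℕ → ℝ}
    (hs : ∀ n, s n ∈ Set.Ioo (0 : ℝ) 1) (hs0 : Tendsto s atTop (𝓝 0)) {u : PerLp d T p}
    {w : ℕ → PerLp d T p} (hw : WeakTendsto w u) :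
    ENNReal.ofReal (d * unitBallVolume d / (p * T ^ d)) * energyZero u ≤
      liminf (fun n => ENNReal.ofReal (s n) * energy (s n) (w n)) atTop := by
  set c := (d : ℝ) * unitBallVolume d / (p * T ^ d)
  have key : ∀ R : ℝ, 0 < R →
      ENNReal.ofReal ((1 + T * √d / R) ^ (-(d : ℝ)) * c) * energyZero u ≤
        liminf (fun n => ENNReal.ofReal (s n) * energy (s n) (w n)) atTop := by
    intro R hR
    have h1 := (ENNReal.continuous_ofReal.tendsto _).comp (tendsto_lowerConst (p := p) (d := d)
      hT hR hs0)
    calc _ ≤ liminf (fun n => ENNReal.ofReal (lowerConst d T p R (s n))) atTop *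
          liminf (fun n => energyZero (w n)) atTop :=
          mul_le_mul' h1.liminf_eq.ge (energyZero_le_liminf hw)
      _ ≤ liminf ((fun n => ENNReal.ofReal (lowerConst d T p R (s n))) *
          fun n => energyZero (w n)) atTop := ENNReal.le_liminf_mul
      _ ≤ _ := liminf_le_liminf (Eventually.of_forall fun n =>
          lowerConst_mul_energyZero_le hd hT hp.out hR (hs n).1 (w n))
  have hlim : Tendsto (fun R : ℝ => ENNReal.ofReal ((1 + T * √d / R) ^ (-(d : ℝ)) * c) *
      energyZero u) atTop (𝓝 (ENNReal.ofReal c * energyZero u)) :=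
    ENNReal.Tendsto.mul_const ((ENNReal.continuous_ofReal.tendsto _).comp
      (tendsto_one_add_div_rpow_mul c _ _)) (Or.inr (energyZero_ne_top u))
  exact le_of_tendsto hlim ((eventually_gt_atTop 0).mono key)

theorem limsup_energy_le_of_lipschitz (hd : 1 ≤ d) (hT : 0 < T) [hp : Fact (1 ≤ p)] {s : ℕ → ℝ}
    (hs : ∀ n, s n ∈ Set.Ioo (0 : ℝ) 1) (hs0 : Tendsto s atTop (𝓝 0)) {u : PerLp d T p}
    {L : ℝ} (hL : 0 ≤ L) (hu : ∀ x y, |u x - u y| ≤ L * ‖x - y‖) :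
    limsup (fun n => ENNReal.ofReal (s n) * energy (s n) u) atTop ≤
      ENNReal.ofReal (d * unitBallVolume d / (p * T ^ d)) * energyZero u := by
  have hp0 : 0 < p := zero_lt_one.trans_le hp.out
  set c := (d : ℝ) * unitBallVolume d / (p * T ^ d)
  have key : ∀ R : ℝ, 0 < R →
      limsup (fun n => ENNReal.ofReal (s n) * energy (s n) u) atTop ≤
        ENNReal.ofReal ((1 + T * √d / R) ^ (d : ℝ) * c) * energyZero u := by
    intro R hR
    have h1 := (ENNReal.continuous_ofReal.tendsto _).comp (tendsto_upperConst (p := p) (d := d)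
      hT hR hs0)
    have hR' : R + T * √d ≠ 0 := by positivity
    have hb : Tendsto (fun n => p * (1 - s n)) atTop (𝓝 (p * (1 - 0))) :=
      (hs0.const_sub 1).const_mul p
    have h2 : Tendsto (fun n => s n * (T ^ d * (L ^ p * (d * unitBallVolume d *
        ((R + T * √d) ^ (p * (1 - s n)) / (p * (1 - s n))))))) atTop (𝓝 (0 * (T ^ d * (L ^ p *
        (d * unitBallVolume d * ((R + T * √d) ^ (p * (1 - 0)) / (p * (1 - 0)))))))) :=
      hs0.mul (((((((Real.continuous_const_rpow hR').tendsto _).comp hb).div hb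
        (by simpa using hp0.ne')).const_mul _).const_mul _).const_mul _)
    rw [zero_mul] at h2
    have h3 := (ENNReal.Tendsto.mul_const h1 (Or.inr (energyZero_ne_top u))).add
      ((ENNReal.continuous_ofReal.tendsto _).comp h2)
    rw [ENNReal.ofReal_zero, add_zero] at h3
    rw [← h3.limsup_eq]
    exact limsup_le_limsup (Eventually.of_forall fun n =>
      energy_le_of_lipschitz hd hT hp.out hR (hs n).1 (hs n).2 u hL hu)
  have hlim : Tendsto (fun R : ℝ => ENNReal.ofReal ((1 + T * √d / R) ^ (d : ℝ) * c) *
      energyZero u) atTop (𝓝 (ENNReal.ofReal c * energyZero u)) :=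
    ENNReal.Tendsto.mul_const ((ENNReal.continuous_ofReal.tendsto _).comp
      (tendsto_one_add_div_rpow_mul c _ _)) (Or.inr (energyZero_ne_top u))
  exact ge_of_tendsto hlim ((eventually_gt_atTop 0).mono key)

theorem exists_recovery_sequence (hd : 1 ≤ d) (hT : 0 < T) [hp : Fact (1 ≤ p)] {s : ℕ → ℝ}
    (hs : ∀ n, s n ∈ Set.Ioo (0 : ℝ) 1) (hs0 : Tendsto s atTop (𝓝 0)) (u : PerLp d T p) :
    ∃ w : ℕ → PerLp d T p, WeakTendsto w u ∧
      limsup (fun n => ENNReal.ofReal (s n) * energy (s n) (w n)) atTop ≤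
        ENNReal.ofReal (d * unitBallVolume d / (p * T ^ d)) * energyZero u := by
  set c := (d : ℝ) * unitBallVolume d / (p * T ^ d)
  choose v hv L hL hvL using fun j : ℕ =>
    exists_lipschitz_norm_sub_le hT u (Nat.one_div_pos_of_nat (α := ℝ) (n := j))
  have hvu : Tendsto v atTop (𝓝 u) := by
    rw [tendsto_iff_norm_sub_tendsto_zero]
    refine squeeze_zero (fun _ => norm_nonneg _) (fun j => ?_)
      (tendsto_one_div_add_atTop_nhds_zero_nat (𝕜 := ℝ))
    rw [norm_sub_rev]
    exact hv j
  -- The slack `1/(j+1)` makes the inequality strict, so that a bound on the limsup holds eventually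
  -- along the sequence.
  set b : ℕ → ℝ≥0∞ := fun j => ENNReal.ofReal c * energyZero (v j) +
    ENNReal.ofReal (1 / ((j : ℝ) + 1))
  have hb : Tendsto b atTop (𝓝 (ENNReal.ofReal c * energyZero u)) := by
    have h1 := ENNReal.Tendsto.const_mul (a := ENNReal.ofReal c)
      ((continuous_energyZero.tendsto u).comp hvu) (Or.inr ENNReal.ofReal_ne_top)
    have h2 := (ENNReal.continuous_ofReal.tendsto _).comp
      (tendsto_one_div_add_atTop_nhds_zero_nat (𝕜 := ℝ))
    rw [ENNReal.ofReal_zero] at h2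
    have h3 := h1.add h2
    rw [add_zero] at h3
    exact h3
  have hev : ∀ j, ∀ᶠ n in atTop, ENNReal.ofReal (s n) * energy (s n) (v j) ≤ b j := by
    intro j
    have h1 := limsup_energy_le_of_lipschitz hd hT hs hs0 (hL j) (hvL j)
    have h2 : ENNReal.ofReal c * energyZero (v j) < b j :=
      ENNReal.lt_add_right (ENNReal.mul_ne_top ENNReal.ofReal_ne_top (energyZero_ne_top _))
        (ENNReal.ofReal_pos.2 Nat.one_div_pos_of_nat).ne'
    exact (eventually_lt_of_limsup_lt (h1.trans_lt h2)).mono fun n hn => hn.le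
  obtain ⟨k, hk, hk'⟩ := exists_diagonal hev
  refine ⟨fun n => v (k n), weakTendsto_of_tendsto (hvu.comp hk), ?_⟩
  rw [← (hb.comp hk).limsup_eq]
  exact limsup_le_limsup hk'

/-- The lower bound with `R = 1` has a constant tending to `κ > 0`, hence above `κ / 2` from some
`N` on; it bounds `F^0_p(u n)`, and Poincaré's inequality bounds the centred functions. -/
theorem exists_bound_norm_center (hd : 1 ≤ d) (hT : 0 < T) [hp : Fact (1 ≤ p)] {s : ℕ → ℝ}
    (hs : ∀ n, s n ∈ Set.Ioo (0 : ℝ) 1) (hs0 : Tendsto s atTop (𝓝 0)) {u : ℕ → PerLp d T p}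
    {C : ℝ≥0∞} (hC : C ≠ ∞) (hu : ∀ n, ENNReal.ofReal (s n) * energy (s n) (u n) ≤ C) :
    ∃ B : ℝ, ∃ N, ∀ n, ‖center (u (n + N))‖ ≤ B := by
  have hp0 : 0 < p := zero_lt_one.trans_le hp.out
  have hd0 : (0 : ℝ) < d := by exact_mod_cast hd
  have hω := unitBallVolume_pos d
  have hlim := tendsto_lowerConst (p := p) (d := d) hT zero_lt_one hs0
  set κ := (1 + T * √d / 1) ^ (-(d : ℝ)) * (d * unitBallVolume d / (p * T ^ d))
  have hκ : 0 < κ := by positivity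
  obtain ⟨N, hN⟩ := eventually_atTop.1 (hlim.eventually (lt_mem_nhds (half_lt_self hκ)))
  have hexp : 0 ≤ 1 - 1 / p := by
    rw [sub_nonneg, div_le_one hp0]; exact hp.out
  set P := (ENNReal.ofReal (1 / T ^ d) * volume (cell d T) ^ (1 - 1 / p)) ^ p
  have hP : P ≠ ∞ := ENNReal.rpow_ne_top_of_nonneg hp0.le (ENNReal.mul_ne_top
    ENNReal.ofReal_ne_top (ENNReal.rpow_ne_top_of_nonneg hexp (cell_volume_lt_top d T).ne))
  have hκ' : ENNReal.ofReal (κ / 2) ≠ 0 := (ENNReal.ofReal_pos.2 (half_pos hκ)).ne'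
  have hbound : ∀ n, ‖center (u (n + N))‖ₑ ≤
      (P * (C / ENNReal.ofReal (κ / 2))) ^ (1 / p) := by
    intro n
    have h1 : energyZero (u (n + N)) ≤ C / ENNReal.ofReal (κ / 2) := by
      rw [ENNReal.le_div_iff_mul_le (Or.inl hκ') (Or.inl ENNReal.ofReal_ne_top), mul_comm]
      calc _ ≤ ENNReal.ofReal (lowerConst d T p 1 (s (n + N))) * energyZero (u (n + N)) :=
            mul_le_mul' (ENNReal.ofReal_le_ofReal (hN _ (Nat.le_add_left N n)).le) le_rfl
        _ ≤ _ := lowerConst_mul_energyZero_le hd hT hp.out zero_lt_one (hs _).1 _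
        _ ≤ C := hu _
    rw [one_div, ENNReal.le_rpow_inv_iff hp0]
    exact (enorm_center_rpow_le hT _).trans (mul_le_mul' le_rfl h1)
  have hfin : (P * (C / ENNReal.ofReal (κ / 2))) ^ (1 / p) ≠ ∞ :=
    ENNReal.rpow_ne_top_of_nonneg (by positivity)
      (ENNReal.mul_ne_top hP (ENNReal.div_ne_top hC hκ'))
  refine ⟨((P * (C / ENNReal.ofReal (κ / 2))) ^ (1 / p)).toReal, N, fun n => ?_⟩
  rw [← toReal_enorm]
  exact ENNReal.toReal_mono hfin (hbound n)

theorem exists_weakTendsto_center (hd : 1 ≤ d) (hT : 0 < T) [Fact (1 ≤ p)] (hp : 1 < p)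
    {s : ℕ → ℝ} (hs : ∀ n, s n ∈ Set.Ioo (0 : ℝ) 1) (hs0 : Tendsto s atTop (𝓝 0))
    {u : ℕ → PerLp d T p} {C : ℝ≥0∞} (hC : C ≠ ∞)
    (hu : ∀ n, ENNReal.ofReal (s n) * energy (s n) (u n) ≤ C) :
    ∃ φ : ℕ → ℕ, StrictMono φ ∧ ∃ v : PerLp d T p,
      WeakTendsto (fun k => center (u (φ k))) v ∧ cellAverage v = 0 := by
  obtain ⟨B, N, hB⟩ := exists_bound_norm_center hd hT hs hs0 hC hu
  obtain ⟨φ, hφ, v, hv⟩ := exists_weakTendsto_subseq hT hp hB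
  obtain ⟨A, hA⟩ := exists_cellAverage_clm (d := d) (T := T) (p := p)
  -- The subsequence was extracted from the sequence shifted by `N`. The average is a continuous
  -- functional, so it passes to the weak limit and vanishes there.
  refine ⟨fun k => φ k + N, fun i j hij => Nat.add_lt_add_right (hφ hij) N, v, hv, ?_⟩
  have h := weakTendsto_iff.1 hv A
  simp only [hA, cellAverage_center hT] at h
  exact (tendsto_nhds_unique h tendsto_const_nhds)

end GammaConvergence

end PeriodicGagliardo

theorem mainTheorem1 (d : ℕ) (hd : 1 ≤ d) (T : ℝ) (hT : 0 < T) (p : ℝ) [Fact (1 ≤ p)]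
    (s : ℕ → ℝ) (hs : ∀ n, s n ∈ Set.Ioo (0 : ℝ) 1) (hs0 : Tendsto s atTop (𝓝 0)) :
    -- Compactness
    (p ≠ 1 → ∀ u : ℕ → PeriodicGagliardo.PerLp d T p, ∀ C : ℝ,
      (⨆ n, ENNReal.ofReal (s n) * PeriodicGagliardo.energy (s n) (u n)) ≤ ENNReal.ofReal C →
      ∃ φ : ℕ → ℕ, StrictMono φ ∧ ∃ v : PeriodicGagliardo.PerLp d T p,
        PeriodicGagliardo.WeakTendsto (fun k => PeriodicGagliardo.center (u (φ k))) v ∧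
        PeriodicGagliardo.cellAverage v = 0) ∧
    -- Lower bound
    (∀ (u : PeriodicGagliardo.PerLp d T p) (w : ℕ → PeriodicGagliardo.PerLp d T p),
      PeriodicGagliardo.WeakTendsto w u →
      ENNReal.ofReal (d * PeriodicGagliardo.unitBallVolume d / (p * T ^ d)) *
          PeriodicGagliardo.energyZero u ≤
        liminf (fun n => ENNReal.ofReal (s n) * PeriodicGagliardo.energy (s n) (w n)) atTop) ∧
    -- Upper bound
    (∀ u : PeriodicGagliardo.PerLp d T p, ∃ w : ℕ → PeriodicGagliardo.PerLp d T p,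
      PeriodicGagliardo.WeakTendsto w u ∧
      limsup (fun n => ENNReal.ofReal (s n) * PeriodicGagliardo.energy (s n) (w n)) atTop ≤
        ENNReal.ofReal (d * PeriodicGagliardo.unitBallVolume d / (p * T ^ d)) *
          PeriodicGagliardo.energyZero u) := by
  refine ⟨fun hp u C hC => ?_, fun u w hw => ?_, fun u => ?_⟩
  · exact PeriodicGagliardo.exists_weakTendsto_center hd hT
      (lt_of_le_of_ne Fact.out (Ne.symm hp)) hs hs0 ENNReal.ofReal_ne_top (iSup_le_iff.1 hC)
  · exact PeriodicGagliardo.mul_energyZero_le_liminf hd hT hs hs0 hw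
  · exact PeriodicGagliardo.exists_recovery_sequence hd hT hs hs0 u
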